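/- Let $l,d,\lambda,Z_0,P,n_0>0$ be real numbers. For $r,s\in[0,l]$ put $x=r-s$, $\rho=\sqrt{x^2+d^2}$ and let $$G(r,s)=\frac{\mathrm{j}Z_0e^{\mathrm{j}2\pi\rho/\lambda}}{2\lambda\rho}\left[\frac{\mathrm{j}}{2\pi\rho/\lambda}\,\frac{d^2-2x^2}{x^2+d^2}+\frac{d^2}{x^2+d^2}-\frac{1}{(2\pi/\lambda)^2(x^2+d^2)}\,\frac{d^2-2x^2}{x^2+d^2}\right]$$ be the Green's function (component along the lines) between two parallel segments of length $l$ at distance $d$, at wavelength $\lambda$. Let $K_E(r,r')=P\int_0^lG(r,s)G^*(r',s)\,\mathrm{d}s$ be the autocorrelation of the received field, and let $T_E$ be the integral operator on $L^2([0,l])$ with kernel $K_E$. For $m\ge1$ let $r_i=(i-\tfrac12)l/m$, $i=1,\dots,m$, be the positions of $m$ point antennas, and define the noise power by the SNR control rule $$n_1=n_1(m)=n_0\,\frac{\sum_{i=1}^mK_E(r_i,r_i)}{\int_0^lK_E(r,r)\,\mathrm{d}r}.$$ Define the mutual informations $$I_1(m)=\log\det\left(\mathbb{1}_{i=j}+\frac{K_E(r_i,r_j)}{n_1/2}\right)_{i,j=1}^m,\qquad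 I_0=\log\det\left(\mathbf 1+\frac{T_E}{n_0/2}\right),$$ where the second determinant is the Fredholm determinant $$\det(\mathbf 1+zT_E)=\sum_{n=0}^\infty\frac{z^n}{n!}\int_{[0,l]^n}\det\big(K_E(x_i,x_j)\big)_{i,j=1}^n\,\mathrm{d}x_1\cdots\mathrm{d}x_n .$$ Then $n_1(m)>0$ for all $m\ge1$, the Fredholm series converges absolutely at $z=2/n_0$, and both determinants are real and positive. The nonzero eigenvalues of $T_E$, repeated according to multiplicity, can be listed as a sequence (padded, where necessary, with zeros) that belongs to an orthonormal sequence of eigenfunctions of $T_E$ on whose orthogonal complement $T_E$ vanishes. For each such sequence $(\lambda_k)$ all $\lambda_k$ are nonnegative and $$I_0=\sum_k\log\left(1+\frac{\lambda_k}{n_0/2}\right).$$ Moreover $I_1(m)\to I_0$ as $m\to\infty$, and there is a constant $C$, depending only on $l,d,\lambda,Z_0,P,n_0$, such that $$|I_1(m)-I_0|\le\frac{C}{m^2}\qquad\text{for all }m\ge1.$$ -/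

import Mathlib

namespace LinearAntenna

noncomputable section

/-- The `zz` component of the free-space dyadic Green's function between the source point
`(0, 0, s)` and the observation point `(d, 0, r)`, for wavelength `wl` and intrinsic
impedance `Z₀`. -/
def green (d wl Z₀ r s : ℝ) : ℂ :=
  let x : ℝ := r - s
  let ρ : ℝ := Real.sqrt (x ^ 2 + d ^ 2)
  Complex.I * (Z₀ : ℂ) * Complex.exp (Complex.I * ((2 * Real.pi * ρ / wl : ℝ) : ℂ))
      / ((2 * wl * ρ : ℝ) : ℂ)
    * (Complex.I / ((2 * Real.pi * ρ / wl : ℝ) : ℂ)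
          * (((d ^ 2 - 2 * x ^ 2) / (x ^ 2 + d ^ 2) : ℝ) : ℂ)
        + ((d ^ 2 / (x ^ 2 + d ^ 2) : ℝ) : ℂ)
        - ((1 / ((2 * Real.pi / wl) ^ 2 * (x ^ 2 + d ^ 2))
            * ((d ^ 2 - 2 * x ^ 2) / (x ^ 2 + d ^ 2)) : ℝ) : ℂ))

/-- The autocorrelation `K_E(r, r') = P ∫₀ˡ G(r, s) G*(r', s) ds` of the received field. -/
def fieldKernel (l d wl Z₀ P r r' : ℝ) : ℂ :=
  (P : ℂ) * ∫ s in (0 : ℝ)..l, green d wl Z₀ r s * (starRingEnd ℂ) (green d wl Z₀ r' s)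

/-- The integral operator on `[0, l]` with kernel `K`, acting on functions. -/
def integralOperator (l : ℝ) (K : ℝ → ℝ → ℂ) (φ : ℝ → ℂ) (r : ℝ) : ℂ :=
  ∫ r' in (0 : ℝ)..l, K r r' * φ r'

/-- The Hilbert space `L²([0, l]; ℂ)`. -/
abbrev L2 (l : ℝ) : Type :=
  MeasureTheory.Lp ℂ 2
    ((MeasureTheory.volume : MeasureTheory.Measure ℝ).restrict (Set.Icc 0 l))

/-- `ev` lists the eigenvalues of the integral operator with kernel `K` on `L²([0, l])`, each
nonzero one repeated according to its multiplicity: there is an orthonormal sequence of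
eigenfunctions with these eigenvalues, and the operator vanishes on its orthogonal complement. -/
def IsEigenvalueSequence (l : ℝ) (K : ℝ → ℝ → ℂ) (ev : ℕ → ℝ) : Prop :=
  ∃ φ : ℕ → L2 l, Orthonormal ℂ φ ∧
    (∀ k, ∀ᵐ r ∂(MeasureTheory.volume.restrict (Set.Icc 0 l)),
      integralOperator l K (φ k) r = (ev k : ℂ) * φ k r) ∧
    ∀ f : L2 l, (∀ k, inner ℂ (φ k) f = 0) →
      ∀ᵐ r ∂(MeasureTheory.volume.restrict (Set.Icc 0 l)), integralOperator l K f r = 0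

/-- The `n`-th term of the Fredholm series of `det (1 + z T)`, where `T` is the integral
operator on `[0, l]` with kernel `K`. -/
def fredholmTerm (l : ℝ) (K : ℝ → ℝ → ℂ) (z : ℂ) (n : ℕ) : ℂ :=
  z ^ n / (n.factorial : ℂ) *
    ∫ x : Fin n → ℝ in Set.univ.pi (fun _ => Set.Icc (0 : ℝ) l),
      (Matrix.of fun i j : Fin n => K (x i) (x j)).det

/-- The Fredholm determinant `det (1 + z T)` of the integral operator `T` on `[0, l]` with
kernel `K`. -/
def fredholmDet (l : ℝ) (K : ℝ → ℝ → ℂ) (z : ℂ) : ℂ :=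
  ∑' n : ℕ, fredholmTerm l K z n

/-- The mutual information `I₀ = log det (1 + T_E / (n₀ / 2))` of the continuous receiver. -/
def contInfo (l d wl Z₀ P n₀ : ℝ) : ℝ :=
  Real.log (fredholmDet l (fieldKernel l d wl Z₀ P) ((1 / (n₀ / 2) : ℝ) : ℂ)).re

/-- The positions `(i - 1/2) l / m`, `i = 1, …, m`, of the point antennas (indexed from `0`). -/
def antenna (l : ℝ) (m : ℕ) (i : Fin m) : ℝ :=
  ((i : ℝ) + 1 / 2) * l / m

/-- The noise power `n₁ = n₀ (∑ᵢ K_E(rᵢ, rᵢ)) / ∫₀ˡ K_E(r, r) dr` given by the SNR control rule.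
The numbers `K_E(r, r)` are real. -/
def noisePower (l d wl Z₀ P n₀ : ℝ) (m : ℕ) : ℝ :=
  n₀ * (∑ i : Fin m, (fieldKernel l d wl Z₀ P (antenna l m i) (antenna l m i)).re)
    / ∫ r in (0 : ℝ)..l, (fieldKernel l d wl Z₀ P r r).re

/-- The determinant of `1_{i=j} + K_E(rᵢ, rⱼ) / (n₁ / 2)`. -/
def discreteDet (l d wl Z₀ P n₀ : ℝ) (m : ℕ) : ℂ :=
  (Matrix.of fun i j : Fin m =>
    (if i = j then (1 : ℂ) else 0)
      + fieldKernel l d wl Z₀ P (antenna l m i) (antenna l m j)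
        / ((noisePower l d wl Z₀ P n₀ m / 2 : ℝ) : ℂ)).det

/-- The mutual information `I₁` of the receiver with `m` point antennas. -/
def discreteInfo (l d wl Z₀ P n₀ : ℝ) (m : ℕ) : ℝ :=
  Real.log (discreteDet l d wl Z₀ P n₀ m).re

end

end LinearAntenna

/-! ### Determinant estimates and the Fredholm series of a finite matrix. -/

namespace LinearAntenna

section

open scoped Nat Matrix ComplexOrder

/-! The Green's function has the form `g (r - s)` with `g` even, of class C² (because `d > 0`) and
nowhere zero. Evenness exchanges the roles of antennas and sources. By the identity det(1 + AB) =
det(1 + BA), in its Fredholm form `fredholmDet_finiteRank`, the determinant of the `m` antennas is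
exactly the Fredholm determinant of a finite-rank kernel on `[0, l]`. That kernel is `m / l` times
`quadKernel`, the midpoint rule with nodes `rᵢ` for the integral over `s` that defines `K_E`. The
discrete and the continuous receiver are thus compared as two kernels on one interval
(`det_one_add_autocorr_eq`).

The midpoint error is O(1/m²) uniformly in both arguments. The SNR rule absorbs the factor `m / l`:
the parameter becomes `z τ / τₘ`, where `z = 2 / n₀` and `τ`, `τₘ` are the traces of `K_E` and of
`quadKernel`. So it too differs from `z` by O(1/m²). By Hadamard's inequality the Fredholm
determinant is Lipschitz in the supremum norm on bounded sets of kernels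
(`exists_norm_fredholmDet_sub_le`). Both determinants are at least 1, where the logarithm is
1-Lipschitz, and the rate follows.

For the eigenvalue formula, `K_E(x, y) = ⟪v x, v y⟫` for a continuous feature map `v`, so `T_E = E
E*` with `E g = ⟪v ·, g⟫` compact. The normalized vectors `E* φₖ` give the Mercer expansion
pointwise (`hasSum_mercer`). Its truncations are uniformly bounded finite-rank kernels with
determinants `∏ (1 + z λₖ)`, and dominated convergence passes to the limit. -/

/-- Hadamard's inequality for matrices with bounded entries. -/
theorem norm_det_le_of_norm_le {n : ℕ} (A : Matrix (Fin n) (Fin n) ℂ) {M : ℝ} (hM : 0 ≤ M)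
    (hA : ∀ i j, ‖A i j‖ ≤ M) : ‖A.det‖ ≤ √((n : ℝ) ^ n) * M ^ n := by
  rcases Nat.eq_zero_or_pos n with rfl | hn
  · simp
  have hn' : (0 : ℝ) < n := by exact_mod_cast hn
  -- The eigenvalues of `A Aᴴ` have product `|det A|²` and sum at most `n² M²`; the AM-GM inequality
  -- compares the two.
  have hpsd : (A * Aᴴ).PosSemidef := Matrix.posSemidef_self_mul_conjTranspose A
  set ev := hpsd.isHermitian.eigenvalues with hev
  have hev0 : ∀ i, 0 ≤ ev i := hpsd.eigenvalues_nonneg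
  have hdet : ‖A.det‖ ^ 2 = ∏ i, ev i := by
    have h1 : (A * Aᴴ).det = ((∏ i, ev i : ℝ) : ℂ) := by
      rw [hpsd.isHermitian.det_eq_prod_eigenvalues]; push_cast; rfl
    rw [Matrix.det_mul, Matrix.det_conjTranspose] at h1
    have h2 : ((‖A.det‖ ^ 2 : ℝ) : ℂ) = ((∏ i, ev i : ℝ) : ℂ) := by
      rw [← h1]; push_cast; exact (Complex.mul_conj' _).symm
    exact_mod_cast h2
  have htr : ∑ i, ev i ≤ n * (n * M ^ 2) := by
    have h1 : (A * Aᴴ).trace = ((∑ i, ev i : ℝ) : ℂ) := by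
      rw [hpsd.isHermitian.trace_eq_sum_eigenvalues]; push_cast; rfl
    have h2 : (A * Aᴴ).trace = ((∑ i, ∑ j, ‖A i j‖ ^ 2 : ℝ) : ℂ) := by
      simp only [Matrix.trace, Matrix.diag, Matrix.mul_apply, Matrix.conjTranspose_apply]
      push_cast
      exact Finset.sum_congr rfl fun i _ => Finset.sum_congr rfl fun j _ => Complex.mul_conj' _
    have h3 : ∑ i, ev i = ∑ i, ∑ j, ‖A i j‖ ^ 2 := by
      rw [h1] at h2; exact_mod_cast h2
    rw [h3]
    calc ∑ i, ∑ j, ‖A i j‖ ^ 2 ≤ ∑ _i : Fin n, ∑ _j : Fin n, M ^ 2 := by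
          gcongr with i _ j _; exact hA i j
      _ = n * (n * M ^ 2) := by simp
  have hamgm : ∏ i, ev i ≤ ((n : ℝ) * M ^ 2) ^ n := by
    have h := Real.geom_mean_le_arith_mean_weighted Finset.univ (fun _ : Fin n => (1 / n : ℝ)) ev
      (fun _ _ => by positivity) (by simp [hn'.ne']) (fun i _ => hev0 i)
    have h' : ∏ i, ev i = (∏ i, ev i ^ (1 / n : ℝ)) ^ n := by
      rw [← Finset.prod_pow]
      refine Finset.prod_congr rfl fun i _ => ?_
      rw [← Real.rpow_natCast, ← Real.rpow_mul (hev0 i)]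
      simp [hn'.ne']
    rw [h']
    refine pow_le_pow_left₀ (Finset.prod_nonneg fun i _ => Real.rpow_nonneg (hev0 i) _)
      (h.trans ?_) n
    rw [← Finset.mul_sum, one_div, inv_mul_le_iff₀ hn']
    exact htr
  have h0 : 0 ≤ √((n : ℝ) ^ n) * M ^ n := by positivity
  refine le_of_sq_le_sq ?_ h0
  rw [hdet, mul_pow, Real.sq_sqrt (by positivity), ← pow_mul, mul_comm n 2, pow_mul, ← mul_pow]
  exact hamgm

/-- Rescale every row to supremum norm one and apply Hadamard. In this form it is the bound on a
multilinear map needed for a Lipschitz estimate. -/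
theorem norm_det_le_prod_norm_row {n : ℕ} (A : Fin n → Fin n → ℂ) :
    ‖(Matrix.of A).det‖ ≤ √((n : ℝ) ^ n) * ∏ i, ‖A i‖ := by
  by_cases h0 : ∃ i, A i = 0
  · obtain ⟨i, hi⟩ := h0
    rw [Matrix.det_eq_zero_of_row_eq_zero i (fun j => by simp [hi])]
    simp only [norm_zero]
    exact mul_nonneg (Real.sqrt_nonneg _) (Finset.prod_nonneg fun i _ => norm_nonneg _)
  push Not at h0
  have hA : Matrix.of A = Matrix.of fun i j => ((‖A i‖ : ℝ) : ℂ) * (A i j / (‖A i‖ : ℂ)) := by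
    ext i j
    have : ((‖A i‖ : ℝ) : ℂ) ≠ 0 := by exact_mod_cast norm_ne_zero_iff.2 (h0 i)
    simp only [Matrix.of_apply]; field_simp
  rw [hA]
  have h1 := Matrix.det_mul_column (fun i => ((‖A i‖ : ℝ) : ℂ))
    (Matrix.of fun i j => A i j / (‖A i‖ : ℂ))
  simp only [Matrix.of_apply] at h1
  rw [h1, norm_mul, norm_prod]
  have h2 := norm_det_le_of_norm_le (Matrix.of fun i j => A i j / (‖A i‖ : ℂ)) zero_le_one
    (fun i j => by
      simp only [Matrix.of_apply, norm_div, Complex.norm_real, norm_norm]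
      exact div_le_one_of_le₀ (norm_le_pi_norm (A i) j) (norm_nonneg _))
  simp only [Complex.norm_real, norm_norm]
  rw [mul_comm]
  refine mul_le_mul_of_nonneg_right (by simpa using h2)
    (Finset.prod_nonneg fun i _ => norm_nonneg _)

theorem norm_det_sub_det_le {n : ℕ} (A B : Fin n → Fin n → ℂ) {M ε : ℝ} (hM : 0 ≤ M) (hε : 0 ≤ ε)
    (hA : ∀ i j, ‖A i j‖ ≤ M) (hB : ∀ i j, ‖B i j‖ ≤ M) (hAB : ∀ i j, ‖A i j - B i j‖ ≤ ε) :
    ‖(Matrix.of A).det - (Matrix.of B).det‖ ≤ √((n : ℝ) ^ n) * n * (M + 1) ^ n * ε := by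
  have h := (Matrix.detRowAlternating (R := ℂ) (n := Fin n)).toMultilinearMap.norm_image_sub_le_of_bound
    (Real.sqrt_nonneg ((n : ℝ) ^ n)) norm_det_le_prod_norm_row A B
  have hle : ∀ {C : Fin n → Fin n → ℂ} {c : ℝ}, 0 ≤ c → (∀ i j, ‖C i j‖ ≤ c) → ‖C‖ ≤ c :=
    fun hc hC => (pi_norm_le_iff_of_nonneg hc).2 fun i => (pi_norm_le_iff_of_nonneg hc).2 (hC i)
  refine h.trans ?_
  rw [Fintype.card_fin]
  -- The base `M + 1 ≥ 1` permits raising the exponent from `n - 1` to `n`, including at `n = 0`.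
  have h1 : max ‖A‖ ‖B‖ ^ (n - 1) ≤ (M + 1) ^ n := by
    calc max ‖A‖ ‖B‖ ^ (n - 1) ≤ (M + 1) ^ (n - 1) := by
          gcongr
          exact max_le ((hle hM hA).trans (by linarith)) ((hle hM hB).trans (by linarith))
      _ ≤ (M + 1) ^ n := pow_le_pow_right₀ (by linarith) (Nat.sub_le _ _)
  have h2 : ‖A - B‖ ≤ ε := hle hε hAB
  gcongr

theorem summable_sqrt_self_pow_mul_pow_div_factorial (X : ℝ) (hX : 0 ≤ X) :
    Summable fun n : ℕ => √((n : ℝ) ^ n) * n * X ^ n / n ! := by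
  have hb : ∀ n : ℕ, √((n : ℝ) ^ n) * n * X ^ n / n ! ≤
      √(Real.exp (16 * Real.exp 1 * X ^ 2)) * (1 / 2) ^ n := by
    intro n
    have hfac : (0 : ℝ) < n ! := by exact_mod_cast n.factorial_pos
    have hn2 : (n : ℝ) ≤ 2 ^ n := by exact_mod_cast Nat.lt_two_pow_self.le
    -- The square of the left side is `(n^n / n!) (X^(2n) / n!)`, and `n^n / n! ≤ e^n`. The factor
    -- 16 under the exponential pays for `(1/4)^n` after the root; half of that decay then absorbs
    -- the remaining factor `n ≤ 2^n`.
    have h1 : √((n : ℝ) ^ n) * X ^ n / n ! ≤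
        √(Real.exp (16 * Real.exp 1 * X ^ 2)) * (1 / 4) ^ n := by
      refine le_of_sq_le_sq ?_ (by positivity)
      rw [div_pow, mul_pow, mul_pow, Real.sq_sqrt (by positivity), Real.sq_sqrt (by positivity)]
      have e1 := Real.pow_div_factorial_le_exp (x := (n : ℝ)) (by positivity) n
      have e2 := Real.pow_div_factorial_le_exp (x := 16 * Real.exp 1 * X ^ 2) (by positivity) n
      calc (n : ℝ) ^ n * (X ^ n) ^ 2 / (n ! : ℝ) ^ 2
          = ((n : ℝ) ^ n / n !) * ((X ^ n) ^ 2 / n !) := by field_simp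
        _ ≤ Real.exp n * ((X ^ n) ^ 2 / n !) := by gcongr
        _ = (16 * Real.exp 1 * X ^ 2) ^ n / n ! * ((1 / 4) ^ n) ^ 2 := by
            rw [← Real.exp_one_pow, mul_pow, mul_pow, ← pow_mul, ← pow_mul, ← pow_mul,
              mul_comm n 2, pow_mul (1 / 4 : ℝ)]
            have : (16 : ℝ) ^ n * ((1 / 4) ^ 2) ^ n = 1 := by
              rw [← mul_pow]; norm_num
            linear_combination (-(Real.exp 1 ^ n * X ^ (2 * n) / n !)) * this
        _ ≤ _ := by gcongr
    calc √((n : ℝ) ^ n) * n * X ^ n / n ! = (√((n : ℝ) ^ n) * X ^ n / n !) * n := by ring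
      _ ≤ (√(Real.exp (16 * Real.exp 1 * X ^ 2)) * (1 / 4) ^ n) * 2 ^ n := by gcongr
      _ = _ := by rw [mul_assoc, ← mul_pow]; norm_num
  exact Summable.of_nonneg_of_le (fun n => by positivity) hb
    ((summable_geometric_of_lt_one (by norm_num) (by norm_num)).mul_left _)

theorem summable_sqrt_self_pow_div_factorial (X : ℝ) (hX : 0 ≤ X) :
    Summable fun n : ℕ => √((n : ℝ) ^ n) * X ^ n / n ! := by
  -- The comparison series has a factor `n`, which is at least 1 only from index 1 on.
  rw [← summable_nat_add_iff 1]
  refine Summable.of_nonneg_of_le (fun n => by positivity) (fun n => ?_)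
    ((summable_nat_add_iff 1).2 (summable_sqrt_self_pow_mul_pow_div_factorial X hX))
  have : (1 : ℝ) ≤ ((n + 1 : ℕ) : ℝ) := by exact_mod_cast Nat.succ_le_succ (Nat.zero_le n)
  gcongr
  exact le_mul_of_one_le_right (Real.sqrt_nonneg _) this

/-- A non-injective `f` repeats a row; each `n`-element set is the image of `n!` injections, all
giving the same principal minor. -/
theorem sum_det_submatrix_eq {N : ℕ} (M : Matrix (Fin N) (Fin N) ℂ) (n : ℕ) :
    ∑ f : Fin n → Fin N, (M.submatrix f f).det =
      n ! * ∑ s ∈ (Finset.univ : Finset (Fin N)).powersetCard n,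
        (M.submatrix (Subtype.val : s → Fin N) (Subtype.val : s → Fin N)).det := by
  classical
  have h0 : ∀ f : Fin n → Fin N, ¬ Function.Injective f → (M.submatrix f f).det = 0 := by
    intro f hf
    simp only [Function.Injective, not_forall] at hf
    obtain ⟨i, j, hij, hne⟩ := hf
    exact Matrix.det_zero_of_row_eq hne (by ext k; simp [hij])
  rw [← Finset.sum_filter_add_sum_filter_not Finset.univ (fun f => Function.Injective f),
    Finset.sum_eq_zero (s := Finset.univ.filter fun f : Fin n → Fin N => ¬ Function.Injective f)
      (fun f hf => h0 f (Finset.mem_filter.1 hf).2), add_zero,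
    ← Finset.sum_fiberwise_of_maps_to (g := fun f => Finset.univ.image f)
      (t := (Finset.univ : Finset (Fin N)).powersetCard n), Finset.mul_sum]
  · refine Finset.sum_congr rfl fun s hs => ?_
    have hs' : s.card = n := (Finset.mem_powersetCard.1 hs).2
    have e₀ : Fin n ≃ s := (Fintype.equivFinOfCardEq (by simpa using hs')).symm
    have key : ∑ _e : Fin n ≃ s,
        (M.submatrix (Subtype.val : s → Fin N) (Subtype.val : s → Fin N)).det =
        ∑ f ∈ Finset.univ.filter (fun f : Fin n → Fin N => Function.Injective f) with
          Finset.univ.image f = s, (M.submatrix f f).det := by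
      refine Finset.sum_nbij (fun e i => (e i : Fin N)) ?_ ?_ ?_ ?_
      · intro e _
        simp only [Finset.mem_filter, Finset.mem_univ, true_and]
        refine ⟨Subtype.val_injective.comp e.injective, ?_⟩
        ext x
        simp only [Finset.mem_image, Finset.mem_univ, true_and]
        constructor
        · rintro ⟨i, rfl⟩; exact (e i).2
        · intro hx; exact ⟨e.symm ⟨x, hx⟩, by simp⟩
      · intro e _ e' _ hee
        ext i
        exact congrArg Fin.val (congrFun hee i)
      · intro f hf
        simp only [Finset.coe_filter, Finset.mem_filter, Finset.mem_univ, true_and,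
          Set.mem_ofPred_eq] at hf
        obtain ⟨hinj, him⟩ := hf
        have hmem : ∀ i, f i ∈ s := fun i => him ▸ Finset.mem_image_of_mem f (Finset.mem_univ i)
        refine ⟨Equiv.ofBijective (fun i => (⟨f i, hmem i⟩ : s)) ⟨?_, ?_⟩, by simp, ?_⟩
        · intro i j hij; exact hinj (congrArg Subtype.val hij)
        · rintro ⟨x, hx⟩
          rw [← him] at hx
          obtain ⟨i, _, rfl⟩ := Finset.mem_image.1 hx
          exact ⟨i, rfl⟩
        · ext i; rfl
      · intro e _
        exact (Matrix.det_submatrix_equiv_self e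
          (M.submatrix (Subtype.val : s → Fin N) (Subtype.val : s → Fin N))).symm
    rw [← key, Finset.sum_const, Finset.card_univ, Fintype.card_equiv e₀]
    simp
  · intro f hf
    rw [Finset.mem_powersetCard]
    refine ⟨Finset.subset_univ _, ?_⟩
    rw [Finset.card_image_of_injective _ (Finset.mem_filter.1 hf).2]; simp

/-- The Fredholm series of a finite matrix. -/
theorem hasSum_det_submatrix {N : ℕ} (M : Matrix (Fin N) (Fin N) ℂ) (z : ℂ) :
    HasSum (fun n : ℕ => z ^ n / (n ! : ℂ) * ∑ f : Fin n → Fin N, (M.submatrix f f).det)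
      (1 + z • M).det := by
  set p := (1 + (Polynomial.X : Polynomial ℂ) • M.map Polynomial.C).det with hp
  have hev : p.eval z = (1 + z • M).det := by
    rw [hp, ← Polynomial.coe_evalRingHom, RingHom.map_det]
    congr 1
    ext i j
    simp only [Polynomial.coe_evalRingHom, RingHom.mapMatrix_apply, Matrix.map_apply,
      Matrix.add_apply, Matrix.smul_apply, smul_eq_mul, Polynomial.eval_add, Polynomial.eval_mul,
      Polynomial.eval_X, Polynomial.eval_C, Matrix.one_apply]
    split_ifs <;> simp
  have hterm : ∀ n : ℕ, z ^ n / (n ! : ℂ) * ∑ f : Fin n → Fin N, (M.submatrix f f).det =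
      p.coeff n * z ^ n := by
    intro n
    have : (n ! : ℂ) ≠ 0 := by exact_mod_cast n.factorial_ne_zero
    rw [sum_det_submatrix_eq, hp, Matrix.coeff_det_one_add_X_smul_eq_sum_minors]
    field_simp
  simp_rw [hterm]
  rw [← hev, Polynomial.eval_eq_sum_range]
  refine hasSum_sum_of_ne_finset_zero fun n hn => ?_
  rw [Polynomial.coeff_eq_zero_of_natDegree_lt (by simpa [Nat.lt_succ_iff] using hn), zero_mul]

end

end LinearAntenna

/-! ### The Fredholm determinant: finite rank and dependence on the kernel. -/

namespace LinearAntenna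

section

open scoped Nat Matrix ComplexOrder
open MeasureTheory

theorem fredholmTerm_eq_integral_pi (l : ℝ) (K : ℝ → ℝ → ℂ) (z : ℂ) (n : ℕ) :
    fredholmTerm l K z n = z ^ n / (n ! : ℂ) *
      ∫ x : Fin n → ℝ, (Matrix.of fun i j : Fin n => K (x i) (x j)).det
        ∂Measure.pi (fun _ : Fin n => (volume : Measure ℝ).restrict (Set.Icc 0 l)) := by
  rw [fredholmTerm, volume_pi, Measure.restrict_pi_pi]

/-- The Fredholm terms of a kernel of finite rank are sums of minors of a finite matrix. -/
theorem fredholmTerm_finiteRank {l : ℝ} {N : ℕ} (a b : Fin N → ℝ → ℂ)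
    (hint : ∀ j k, IntegrableOn (fun x => a j x * b k x) (Set.Icc 0 l)) (z : ℂ) (n : ℕ) :
    fredholmTerm l (fun x y => ∑ k, a k x * b k y) z n =
      z ^ n / (n ! : ℂ) * ∑ f : Fin n → Fin N,
        ((Matrix.of fun j k => ∫ x in Set.Icc 0 l, a j x * b k x).submatrix f f).det := by
  -- Summing over `σ⁻¹` and reindexing collects both factors that depend on `x i`, so the integral
  -- splits into one-dimensional ones.
  have hdet : ∀ x : Fin n → ℝ,
      (Matrix.of fun i j : Fin n => ∑ k, a k (x i) * b k (x j)).det =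
        ∑ f : Fin n → Fin N, ∑ σ : Equiv.Perm (Fin n), ((Equiv.Perm.sign σ : ℤ) : ℂ) *
          ∏ i, (a (f (σ i)) (x i) * b (f i) (x i)) := by
    intro x
    rw [Matrix.det_apply', Finset.sum_comm,
      ← Equiv.sum_comp (Equiv.inv (Equiv.Perm (Fin n)))]
    refine Finset.sum_congr rfl fun σ _ => ?_
    simp only [Matrix.of_apply, Equiv.inv_apply, Equiv.Perm.sign_inv]
    rw [← Finset.mul_sum, Finset.prod_univ_sum, Fintype.piFinset_univ]
    congr 1
    refine Finset.sum_congr rfl fun f _ => ?_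
    rw [Finset.prod_mul_distrib, Finset.prod_mul_distrib]
    congr 1
    rw [← Equiv.prod_comp σ]
    simp
  have hi : ∀ (f : Fin n → Fin N) (σ : Equiv.Perm (Fin n)),
      Integrable (fun x : Fin n → ℝ => ∏ i, (a (f (σ i)) (x i) * b (f i) (x i)))
        (Measure.pi (fun _ : Fin n => (volume : Measure ℝ).restrict (Set.Icc 0 l))) :=
    fun f σ => Integrable.fintype_prod (f := fun i x => a (f (σ i)) x * b (f i) x)
      fun i => hint (f (σ i)) (f i)
  rw [fredholmTerm_eq_integral_pi]
  congr 1
  simp_rw [hdet]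
  rw [integral_finsetSum _ fun f _ => integrable_finsetSum _ fun σ _ => (hi f σ).const_mul _]
  refine Finset.sum_congr rfl fun f _ => ?_
  rw [integral_finsetSum _ fun σ _ => (hi f σ).const_mul _, Matrix.det_apply']
  refine Finset.sum_congr rfl fun σ _ => ?_
  rw [integral_const_mul, integral_fintype_prod_eq_prod (fun i x => a (f (σ i)) x * b (f i) x)]
  rfl

/-- Such an operator factors through `ℂ^N`, and this is det(1 + AB) = det(1 + BA). It serves both
the antenna matrix and the truncated Mercer series. -/
theorem fredholmDet_finiteRank {l : ℝ} {N : ℕ} (a b : Fin N → ℝ → ℂ)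
    (hint : ∀ j k, IntegrableOn (fun x => a j x * b k x) (Set.Icc 0 l)) (z : ℂ) :
    fredholmDet l (fun x y => ∑ k, a k x * b k y) z =
      (1 + z • Matrix.of fun j k => ∫ x in Set.Icc 0 l, a j x * b k x).det := by
  rw [fredholmDet, funext (fredholmTerm_finiteRank a b hint z)]
  exact (hasSum_det_submatrix _ z).tsum_eq

variable {l : ℝ}

theorem ae_pi_mem_Icc (l : ℝ) (n : ℕ) :
    ∀ᵐ x ∂Measure.pi (fun _ : Fin n => (volume : Measure ℝ).restrict (Set.Icc 0 l)),
      ∀ i, x i ∈ Set.Icc 0 l := by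
  rw [← Measure.restrict_pi_pi]
  filter_upwards [ae_restrict_mem (MeasurableSet.univ_pi fun _ => measurableSet_Icc)] with x hx i
  exact hx i (Set.mem_univ i)

theorem measureReal_pi_Icc (hl : 0 ≤ l) (n : ℕ) :
    (Measure.pi (fun _ : Fin n => (volume : Measure ℝ).restrict (Set.Icc 0 l))).real Set.univ
      = l ^ n := by
  rw [measureReal_def, Measure.pi_univ]
  simp [hl]

theorem continuous_det_kernel {K : ℝ → ℝ → ℂ} (hK : Continuous (Function.uncurry K)) (n : ℕ) :
    Continuous fun x : Fin n → ℝ => (Matrix.of fun i j : Fin n => K (x i) (x j)).det := by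
  refine Continuous.matrix_det (continuous_matrix fun i j => ?_)
  exact hK.comp (f := fun x : Fin n → ℝ => (x i, x j)) (by fun_prop)

theorem norm_fredholmTerm_le (hl : 0 ≤ l) {K : ℝ → ℝ → ℂ} {z : ℂ} {M : ℝ} (hM : 0 ≤ M)
    (hK : ∀ x ∈ Set.Icc 0 l, ∀ y ∈ Set.Icc 0 l, ‖K x y‖ ≤ M) (n : ℕ) :
    ‖fredholmTerm l K z n‖ ≤ √((n : ℝ) ^ n) * (‖z‖ * M * l) ^ n / n ! := by
  rw [fredholmTerm_eq_integral_pi, norm_mul, norm_div, norm_pow]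
  have h1 : ‖∫ x : Fin n → ℝ, (Matrix.of fun i j : Fin n => K (x i) (x j)).det
        ∂Measure.pi (fun _ : Fin n => (volume : Measure ℝ).restrict (Set.Icc 0 l))‖ ≤
      √((n : ℝ) ^ n) * M ^ n * l ^ n := by
    rw [← measureReal_pi_Icc hl n]
    refine norm_integral_le_of_norm_le_const ?_
    filter_upwards [ae_pi_mem_Icc l n] with x hx
    exact norm_det_le_of_norm_le _ hM fun i j => hK _ (hx i) _ (hx j)
  calc ‖z‖ ^ n / ‖(n ! : ℂ)‖ * _ ≤ ‖z‖ ^ n / ‖(n ! : ℂ)‖ * (√((n : ℝ) ^ n) * M ^ n * l ^ n) := by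
        gcongr
    _ = _ := by rw [Complex.norm_natCast]; ring

theorem summable_fredholmTerm (hl : 0 ≤ l) {K : ℝ → ℝ → ℂ} {M : ℝ} (hM : 0 ≤ M)
    (hK : ∀ x ∈ Set.Icc 0 l, ∀ y ∈ Set.Icc 0 l, ‖K x y‖ ≤ M) (z : ℂ) :
    Summable (fredholmTerm l K z) :=
  Summable.of_norm_bounded (summable_sqrt_self_pow_div_factorial _ (by positivity))
    (norm_fredholmTerm_le hl hM hK)

theorem fredholmTerm_smul (l : ℝ) (K : ℝ → ℝ → ℂ) (z : ℂ) (n : ℕ) :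
    fredholmTerm l (fun x y => z * K x y) 1 n = fredholmTerm l K z n := by
  simp only [fredholmTerm]
  have : ∀ x : Fin n → ℝ, (Matrix.of fun i j : Fin n => z * K (x i) (x j)).det =
      z ^ n * (Matrix.of fun i j : Fin n => K (x i) (x j)).det := by
    intro x
    have h := Matrix.det_smul (Matrix.of fun i j : Fin n => K (x i) (x j)) z
    rw [Fintype.card_fin] at h
    rw [← h]; rfl
  simp_rw [this, integral_const_mul]
  ring

/-- Moving `z` into the kernel turns a change of noise power into a change of kernel. -/
theorem fredholmDet_smul (l : ℝ) (K : ℝ → ℝ → ℂ) (z : ℂ) :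
    fredholmDet l (fun x y => z * K x y) 1 = fredholmDet l K z :=
  tsum_congr fun n => fredholmTerm_smul l K z n

/-- The Fredholm determinant depends Lipschitz continuously on a bounded kernel. -/
theorem exists_norm_fredholmDet_sub_le (hl : 0 ≤ l) {M : ℝ} (hM : 0 ≤ M) :
    ∃ C : ℝ, 0 ≤ C ∧ ∀ (K K' : ℝ → ℝ → ℂ) (ε : ℝ), 0 ≤ ε → Continuous (Function.uncurry K) →
      Continuous (Function.uncurry K') →
      (∀ x ∈ Set.Icc 0 l, ∀ y ∈ Set.Icc 0 l, ‖K x y‖ ≤ M) →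
      (∀ x ∈ Set.Icc 0 l, ∀ y ∈ Set.Icc 0 l, ‖K' x y‖ ≤ M) →
      (∀ x ∈ Set.Icc 0 l, ∀ y ∈ Set.Icc 0 l, ‖K x y - K' x y‖ ≤ ε) →
      ‖fredholmDet l K 1 - fredholmDet l K' 1‖ ≤ C * ε := by
  have hs := summable_sqrt_self_pow_mul_pow_div_factorial ((M + 1) * l) (by positivity)
  refine ⟨∑' n : ℕ, √((n : ℝ) ^ n) * n * ((M + 1) * l) ^ n / n !,
    tsum_nonneg fun n => by positivity, ?_⟩
  intro K K' ε hε hKc hKc' hK hK' hKK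
  have hterm : ∀ n, ‖fredholmTerm l K 1 n - fredholmTerm l K' 1 n‖ ≤
      √((n : ℝ) ^ n) * n * ((M + 1) * l) ^ n / n ! * ε := by
    intro n
    have hint : ∀ {K : ℝ → ℝ → ℂ}, Continuous (Function.uncurry K) →
        (∀ x ∈ Set.Icc 0 l, ∀ y ∈ Set.Icc 0 l, ‖K x y‖ ≤ M) →
        Integrable (fun x : Fin n → ℝ => (Matrix.of fun i j : Fin n => K (x i) (x j)).det)
          (Measure.pi (fun _ : Fin n => (volume : Measure ℝ).restrict (Set.Icc 0 l))) := by
      intro K hKc hK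
      refine Integrable.of_bound (continuous_det_kernel hKc n).aestronglyMeasurable
        (√((n : ℝ) ^ n) * M ^ n) ?_
      filter_upwards [ae_pi_mem_Icc l n] with x hx
      exact norm_det_le_of_norm_le _ hM fun i j => hK _ (hx i) _ (hx j)
    rw [fredholmTerm_eq_integral_pi, fredholmTerm_eq_integral_pi, ← mul_sub,
      ← integral_sub (hint hKc hK) (hint hKc' hK'), norm_mul]
    have h1 : ‖∫ x : Fin n → ℝ, ((Matrix.of fun i j : Fin n => K (x i) (x j)).det -
          (Matrix.of fun i j : Fin n => K' (x i) (x j)).det)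
        ∂Measure.pi (fun _ : Fin n => (volume : Measure ℝ).restrict (Set.Icc 0 l))‖ ≤
        √((n : ℝ) ^ n) * n * (M + 1) ^ n * ε * l ^ n := by
      rw [← measureReal_pi_Icc hl n]
      refine norm_integral_le_of_norm_le_const ?_
      filter_upwards [ae_pi_mem_Icc l n] with x hx
      exact norm_det_sub_det_le _ _ hM hε (fun i j => hK _ (hx i) _ (hx j))
        (fun i j => hK' _ (hx i) _ (hx j)) (fun i j => hKK _ (hx i) _ (hx j))
    calc ‖(1 : ℂ) ^ n / (n ! : ℂ)‖ * _ ≤ ‖(1 : ℂ) ^ n / (n ! : ℂ)‖ *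
          (√((n : ℝ) ^ n) * n * (M + 1) ^ n * ε * l ^ n) := by gcongr
      _ = _ := by rw [one_pow, norm_div, norm_one, Complex.norm_natCast, mul_pow]; ring
  rw [fredholmDet, fredholmDet, ← (summable_fredholmTerm hl hM hK 1).tsum_sub
    (summable_fredholmTerm hl hM hK' 1), ← tsum_mul_right]
  exact tsum_of_norm_bounded (hs.mul_right ε).hasSum hterm

/-- The Fredholm determinant is continuous under bounded pointwise convergence of kernels. -/
theorem tendsto_fredholmDet (hl : 0 ≤ l) {M : ℝ} (hM : 0 ≤ M) {K : ℝ → ℝ → ℂ}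
    {KN : ℕ → ℝ → ℝ → ℂ} (hKc : ∀ N, Continuous (Function.uncurry (KN N)))
    (hKb : ∀ N, ∀ x ∈ Set.Icc 0 l, ∀ y ∈ Set.Icc 0 l, ‖KN N x y‖ ≤ M)
    (hlim : ∀ x ∈ Set.Icc 0 l, ∀ y ∈ Set.Icc 0 l,
      Filter.Tendsto (fun N => KN N x y) Filter.atTop (nhds (K x y))) (z : ℂ) :
    Filter.Tendsto (fun N => fredholmDet l (KN N) z) Filter.atTop (nhds (fredholmDet l K z)) := by
  refine tendsto_tsum_of_dominated_convergence
    (summable_sqrt_self_pow_div_factorial (‖z‖ * M * l) (by positivity)) (fun n => ?_)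
    (Filter.Eventually.of_forall fun N n => norm_fredholmTerm_le hl hM (hKb N) n)
  simp only [fredholmTerm_eq_integral_pi]
  refine Filter.Tendsto.const_mul _ ?_
  refine tendsto_integral_of_dominated_convergence (fun _ => √((n : ℝ) ^ n) * M ^ n)
    (fun N => (continuous_det_kernel (hKc N) n).aestronglyMeasurable) (integrable_const _)
    (fun N => ?_) ?_
  · filter_upwards [ae_pi_mem_Icc l n] with x hx
    exact norm_det_le_of_norm_le _ hM fun i j => hKb N _ (hx i) _ (hx j)
  · filter_upwards [ae_pi_mem_Icc l n] with x hx
    have hm : Filter.Tendsto (fun N => Matrix.of fun i j : Fin n => KN N (x i) (x j)) Filter.atTop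
        (nhds (Matrix.of fun i j : Fin n => K (x i) (x j))) :=
      tendsto_pi_nhds.2 fun i => tendsto_pi_nhds.2 fun j => hlim _ (hx i) _ (hx j)
    exact ((continuous_id.matrix_det).tendsto _).comp hm

end

end LinearAntenna

/-! ### Diagonalization of compact symmetric operators by a sequence. -/

namespace LinearAntenna

section

open scoped Matrix
open MeasureTheory

section Eigenbasis

variable {X : Type*} [NormedAddCommGroup X] [InnerProductSpace ℂ X]

/-- Orthonormal vectors lie at distance √2, so balls of radius 1/2 about them are disjoint. -/
theorem countable_of_orthonormal [TopologicalSpace.SeparableSpace X] {ι : Type*} {φ : ι → X}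
    (hφ : Orthonormal ℂ φ) : Countable ι := by
  refine Pairwise.countable_of_isOpen_disjoint (s := fun i => Metric.ball (φ i) (1 / 2))
    (fun i j hij => ?_) (fun i => Metric.isOpen_ball)
    (fun i => ⟨φ i, Metric.mem_ball_self (by norm_num)⟩)
  refine Metric.ball_disjoint_ball ?_
  have h : ‖φ i - φ j‖ ^ 2 = 2 := by
    rw [@norm_sub_sq ℂ, hφ.1 i, hφ.1 j, hφ.2 hij]; norm_num
  rw [dist_eq_norm]
  nlinarith [norm_nonneg (φ i - φ j)]

/-- A compact symmetric operator on a separable infinite dimensional Hilbert space is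
diagonalized by an orthonormal sequence. -/
theorem exists_orthonormal_eigenvectors [CompleteSpace X] [TopologicalSpace.SeparableSpace X]
    (hinf : ¬ FiniteDimensional ℂ X) {T : X →L[ℂ] X} (hT : IsCompactOperator T)
    (hsymm : (T : X →ₗ[ℂ] X).IsSymmetric) :
    ∃ (φ : ℕ → X) (ev : ℕ → ℝ), Orthonormal ℂ φ ∧ (∀ k, T (φ k) = (ev k : ℂ) • φ k) ∧
      ∀ f, (∀ k, inner ℂ (φ k) f = 0) → f = 0 := by
  let V : ℂ → Submodule ℂ X := fun μ => Module.End.eigenspace (T : Module.End ℂ X) μ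
  have hclosed : ∀ μ, IsClosed (V μ : Set X) := by
    intro μ
    have : (V μ : Set X) = {x | T x = μ • x} := by
      ext x; exact Module.End.mem_eigenspace_iff
    rw [this]
    exact isClosed_eq T.continuous (continuous_const_smul μ)
  have : ∀ μ, CompleteSpace (V μ) := fun μ => (hclosed μ).completeSpace_coe
  -- A Hilbert basis is taken in every eigenspace, the kernel included. Their union is orthonormal,
  -- and it is total because the eigenspaces have trivial joint orthogonal complement.
  choose w b _ hb using fun μ : ℂ => (orthonormal_empty ℂ (V μ)).exists_hilbertBasis_extension
  have horth : ∀ μ, Orthonormal ℂ (fun i : w μ => (i : V μ)) := fun μ => by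
    rw [← hb μ]; exact (b μ).orthonormal
  let ψ : (Σ μ, w μ) → X := fun a => ((a.2 : V a.1) : X)
  have hψ : Orthonormal ℂ ψ :=
    hsymm.orthogonalFamily_eigenspaces.orthonormal_sigma_orthonormal horth
  have htot : ∀ f : X, (∀ a, inner ℂ (ψ a) f = 0) → f = 0 := by
    intro f hf
    have hmem : f ∈ (⨆ μ, V μ)ᗮ := by
      rw [Submodule.iSup_eq_span, Submodule.mem_orthogonal]
      have : ∀ μ, ∀ u ∈ V μ, inner ℂ u f = 0 := by
        intro μ u hu
        have hs := ((b μ).hasSum_repr ⟨u, hu⟩).mapL (V μ).subtypeL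
        have hs2 := hs.mapL (innerSL ℂ f)
        have h0 : ∀ i, innerSL ℂ f ((V μ).subtypeL ((b μ).repr ⟨u, hu⟩ i • b μ i)) = 0 := by
          intro i
          have h1 : inner ℂ ((b μ i : V μ) : X) f = 0 := by
            rw [hb μ]; exact hf ⟨μ, i⟩
          rw [map_smul, map_smul, innerSL_apply_apply, Submodule.subtypeL_apply,
            inner_eq_zero_symm.1 h1, smul_zero]
        simp only [h0] at hs2
        have := hs2.unique hasSum_zero
        rw [innerSL_apply_apply] at this
        exact inner_eq_zero_symm.1 this
      intro u hu
      induction hu using Submodule.span_induction with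
      | mem x hx => obtain ⟨μ, hμ⟩ := Set.mem_iUnion.1 hx; exact this μ x hμ
      | zero => simp
      | add x y _ _ hx hy => rw [inner_add_left, hx, hy, add_zero]
      | smul a x _ hx => rw [inner_smul_left, hx, mul_zero]
    have hbot := ContinuousLinearMap.orthogonalComplement_iSup_eigenspaces_eq_bot hT hsymm
    have : f ∈ (⊥ : Submodule ℂ X) := by rw [← hbot]; exact hmem
    simpa using this
  have : Countable (Σ μ, w μ) := countable_of_orthonormal hψ
  -- A finite total family would span the whole space. Infinitude allows an indexing by all of `ℕ`.
  have : Infinite (Σ μ, w μ) := by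
    by_contra hfin
    rw [not_infinite_iff_finite] at hfin
    apply hinf
    let F := Submodule.span ℂ (Set.range ψ)
    have : FiniteDimensional ℂ F := FiniteDimensional.span_of_finite ℂ (Set.finite_range ψ)
    have hF : F = ⊤ := by
      rw [← Submodule.orthogonal_eq_bot_iff, Submodule.eq_bot_iff]
      intro f hf
      exact htot f fun a => hf _ (Submodule.subset_span ⟨a, rfl⟩)
    exact ⟨hF ▸ Submodule.fg_span (Set.finite_range ψ)⟩
  obtain ⟨e⟩ : Nonempty ((Σ μ, w μ) ≃ ℕ) := by
    obtain ⟨_⟩ := nonempty_denumerable (Σ μ, w μ)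
    exact ⟨Denumerable.eqv _⟩
  refine ⟨fun k => ψ (e.symm k), fun k => (e.symm k).1.re, hψ.comp _ e.symm.injective, ?_, ?_⟩
  · intro k
    set a := e.symm k
    have hmem : T (ψ a) = a.1 • ψ a := Module.End.mem_eigenspace_iff.1 (a.2 : V a.1).2
    have hne : ψ a ≠ 0 := hψ.ne_zero a
    have hreal : (starRingEnd ℂ) a.1 = a.1 :=
      hsymm.conj_eigenvalue_eq_self
        (Module.End.hasEigenvalue_of_hasEigenvector ⟨(a.2 : V a.1).2, hne⟩)
    rw [Complex.conj_eq_iff_re.1 hreal, hmem]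
  · intro f hf
    refine htot f fun a => ?_
    simpa using hf (e a)

end Eigenbasis

/-- The indicators of the disjoint intervals `(l / (n + 2), l / (n + 1))` are nonzero and
orthogonal. -/
theorem not_finiteDimensional_L2 {l : ℝ} (hl : 0 < l) : ¬ FiniteDimensional ℂ (L2 l) := by
  intro hfd
  let s : ℕ → Set ℝ := fun n => Set.Ioo (l / (n + 2)) (l / (n + 1))
  have hsub : ∀ n, s n ⊆ Set.Icc 0 l := by
    intro n x hx
    refine ⟨(le_trans (by positivity) hx.1.le), hx.2.le.trans ?_⟩
    exact div_le_self hl.le (by linarith [(Nat.cast_nonneg n : (0 : ℝ) ≤ n)])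
  have hfin : ∀ n, ((volume : Measure ℝ).restrict (Set.Icc 0 l)) (s n) ≠ ⊤ := fun n =>
    measure_ne_top _ _
  have hpos : ∀ n, ((volume : Measure ℝ).restrict (Set.Icc 0 l)) (s n) ≠ 0 := by
    intro n
    rw [Measure.restrict_apply measurableSet_Ioo, Set.inter_eq_left.2 (hsub n), Real.volume_Ioo]
    simp only [ne_eq, ENNReal.ofReal_eq_zero, not_le, sub_pos]
    gcongr; norm_num
  let χ : ℕ → L2 l := fun n => indicatorConstLp 2 measurableSet_Ioo (hfin n) (1 : ℂ)
  have hdisj : ∀ i j : ℕ, i < j → Disjoint (s i) (s j) := by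
    intro i j hij
    rw [Set.disjoint_left]
    intro x hx hx'
    have h1 : l / (j + 1) ≤ l / ((i : ℝ) + 2) := by
      have : (i : ℝ) + 1 ≤ j := by exact_mod_cast hij
      exact div_le_div_of_nonneg_left hl.le (by positivity) (by linarith)
    linarith [hx.1, hx'.2]
  have hli : LinearIndependent ℂ χ := by
    refine linearIndependent_of_ne_zero_of_inner_eq_zero (fun n h0 => ?_) (fun i j hij => ?_)
    · have : ‖χ n‖ = 0 := by rw [h0, norm_zero]
      rw [norm_indicatorConstLp (by norm_num) (by norm_num)] at this
      simp only [norm_one, one_mul] at this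
      rw [Real.rpow_eq_zero measureReal_nonneg (by norm_num), measureReal_eq_zero_iff] at this
      exact hpos n this
    · have hd : Disjoint (s i) (s j) := by
        rcases lt_or_gt_of_ne hij with h | h
        · exact hdisj i j h
        · exact (hdisj j i h).symm
      have hd' : s i ∩ s j = ∅ := hd.inter_eq
      simp only [χ]
      rw [L2.inner_indicatorConstLp_indicatorConstLp]
      simp [hd', s] 
  exact (Set.infinite_univ (α := ℕ)) (by
    have := hli.finite
    exact Set.finite_univ)

end

end LinearAntenna

/-! ### Mercer's theorem for kernels `⟪v x, v y⟫` and the product formula. -/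

namespace LinearAntenna

section

open scoped Matrix InnerProductSpace
open MeasureTheory Filter Topology

section Mercer

variable {H : Type*} [NormedAddCommGroup H] [InnerProductSpace ℂ H]
  {l : ℝ} {v : ℝ → H}

theorem exists_norm_le_on_Icc {E : Type*} [NormedAddCommGroup E] {v : ℝ → E} (l : ℝ)
    (hv : Continuous v) :
    ∃ M : ℝ, 0 ≤ M ∧ ∀ x ∈ Set.Icc 0 l, ‖v x‖ ≤ M := by
  obtain ⟨M, hM⟩ := isCompact_Icc.exists_bound_of_continuousOn (s := Set.Icc 0 l) hv.continuousOn
  exact ⟨max M 0, le_max_right _ _, fun x hx => (hM x hx).trans (le_max_left _ _)⟩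

theorem memLp_two_of_continuous {f : ℝ → ℂ} (hf : Continuous f) (l : ℝ) :
    MemLp f 2 ((volume : Measure ℝ).restrict (Set.Icc 0 l)) := by
  obtain ⟨M, -, hM⟩ := exists_norm_le_on_Icc l hf
  refine MemLp.of_bound hf.aestronglyMeasurable M ?_
  filter_upwards [ae_restrict_mem measurableSet_Icc] with x hx
  exact hM x hx

theorem continuous_inner_left (hv : Continuous v) (g : H) : Continuous fun x => ⟪v x, g⟫_ℂ :=
  hv.inner continuous_const

/-- The constant in the comparison of the `L²` norm on `[0, l]` with the supremum norm. -/
noncomputable def supConst (l : ℝ) : ℝ :=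
  (measureUnivNNReal ((volume : Measure ℝ).restrict (Set.Icc 0 l)) : ℝ) ^ ((2 : ENNReal).toReal)⁻¹

theorem supConst_nonneg (l : ℝ) : 0 ≤ supConst l := Real.rpow_nonneg (NNReal.coe_nonneg _) _

theorem norm_L2_le {f : L2 l} {C : ℝ} (hC : 0 ≤ C)
    (h : ∀ᵐ x ∂((volume : Measure ℝ).restrict (Set.Icc 0 l)), ‖f x‖ ≤ C) :
    ‖f‖ ≤ supConst l * C :=
  Lp.norm_le_of_ae_bound hC h

/-- The operator `g ↦ (x ↦ ⟪v x, g⟫)` from `H` to `L²([0, l])`. -/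
noncomputable def evalOp (l : ℝ) (hv : Continuous v) : H →L[ℂ] L2 l :=
  LinearMap.mkContinuous
    { toFun := fun g => (memLp_two_of_continuous (continuous_inner_left hv g) l).toLp
      map_add' := fun f g => by
        rw [← MemLp.toLp_add]
        refine MemLp.toLp_congr _ _ (Eventually.of_forall fun x => ?_)
        simp
      map_smul' := fun c g => by
        rw [RingHom.id_apply, ← MemLp.toLp_const_smul]
        refine MemLp.toLp_congr _ _ (Eventually.of_forall fun x => ?_)
        simp }
    (supConst l * (exists_norm_le_on_Icc l hv).choose)
    (fun g => by
      obtain ⟨h0, hM⟩ := (exists_norm_le_on_Icc l hv).choose_spec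
      rw [mul_assoc]
      refine norm_L2_le (by positivity) ?_
      filter_upwards [MemLp.coeFn_toLp (memLp_two_of_continuous (continuous_inner_left hv g) l),
        ae_restrict_mem measurableSet_Icc] with x hx hxl
      change ‖(memLp_two_of_continuous (continuous_inner_left hv g) l).toLp _ x‖ ≤ _
      rw [hx]
      exact (norm_inner_le_norm _ _).trans
        (mul_le_mul_of_nonneg_right (hM x hxl) (norm_nonneg _)))

theorem coeFn_evalOp (hv : Continuous v) (g : H) :
    evalOp l hv g =ᵐ[(volume : Measure ℝ).restrict (Set.Icc 0 l)] fun x => ⟪v x, g⟫_ℂ :=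
  MemLp.coeFn_toLp (memLp_two_of_continuous (continuous_inner_left hv g) l)

/-- The image of `[0, l]` under `v` is compact, hence within `δ` of a finite-dimensional subspace
`F`. Projecting onto `F` first gives finite-rank operators that approximate in operator norm. -/
theorem isCompactOperator_evalOp (hv : Continuous v) :
    IsCompactOperator (evalOp l hv) := by
  have hc : evalOp l hv ∈ closure {f : H →L[ℂ] L2 l | IsCompactOperator f} := by
    rw [Metric.mem_closure_iff]
    intro ε hε
    have hδ : 0 < ε / (supConst l + 1) / 2 := by have := supConst_nonneg l; positivity
    set δ := ε / (supConst l + 1) / 2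
    obtain ⟨t, ht, hcov⟩ := Metric.totallyBounded_iff.1
      ((isCompact_Icc (a := (0 : ℝ)) (b := l)).image hv).totallyBounded δ hδ
    let F := Submodule.span ℂ t
    have hF : FiniteDimensional ℂ F := FiniteDimensional.span_of_finite ℂ ht
    have hnear : ∀ x ∈ Set.Icc 0 l, ‖v x - F.starProjection (v x)‖ ≤ δ := by
      intro x hx
      obtain ⟨y, hy, hxy⟩ := Set.mem_iUnion₂.1 (hcov ⟨x, hx, rfl⟩)
      rw [Submodule.starProjection_minimal]
      refine (ciInf_le ⟨0, ?_⟩ (⟨y, Submodule.subset_span hy⟩ : F)).trans ?_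
      · rintro _ ⟨z, rfl⟩; exact norm_nonneg _
      · rw [← dist_eq_norm]; exact (Metric.mem_ball.1 hxy).le
    refine ⟨(evalOp l hv).comp F.starProjection, ?_, ?_⟩
    · have h1 : IsCompactOperator (F.orthogonalProjectionOnto : H →L[ℂ] F) := by
        have : LocallyCompactSpace F := .of_finiteDimensional_of_complete ℂ F
        exact (isCompactOperator_id.comp_clm F.orthogonalProjectionOnto :)
      exact h1.clm_comp ((evalOp l hv).comp F.subtypeL)
    · rw [dist_eq_norm]
      have hle : ‖evalOp l hv - (evalOp l hv).comp F.starProjection‖ ≤ supConst l * δ := by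
        refine ContinuousLinearMap.opNorm_le_bound _
          (mul_nonneg (supConst_nonneg l) hδ.le) fun g => ?_
        rw [mul_assoc]
        refine norm_L2_le (by positivity) ?_
        have hsub : (evalOp l hv - (evalOp l hv).comp F.starProjection) g =
            evalOp l hv (g - F.starProjection g) := by simp
        rw [hsub]
        filter_upwards [coeFn_evalOp hv (g - F.starProjection g),
          ae_restrict_mem measurableSet_Icc] with x hx hxl
        rw [hx, inner_sub_right, ← Submodule.inner_starProjection_left_eq_right,
          ← inner_sub_left]
        exact (norm_inner_le_norm _ _).trans
          (mul_le_mul_of_nonneg_right (hnear x hxl) (norm_nonneg _))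
      refine hle.trans_lt ?_
      have h0 := supConst_nonneg l
      calc supConst l * δ < (supConst l + 1) * (2 * δ) := by nlinarith
        _ = ε := by simp only [δ]; field_simp
  rw [isClosed_setOfPred_isCompactOperator.closure_eq] at hc
  exact hc

variable [CompleteSpace H]

open ContinuousLinearMap in
-- This is what makes `E E*` the integral operator with kernel `⟪v x, v y⟫`.
theorem inner_adjoint_evalOp (hv : Continuous v) (f : L2 l) (x : ℝ) :
    ⟪v x, adjoint (evalOp l hv) f⟫_ℂ = ∫ y in Set.Icc 0 l, ⟪v x, v y⟫_ℂ * f y := by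
  rw [adjoint_inner_right, L2.inner_def]
  refine integral_congr_ae ?_
  filter_upwards [coeFn_evalOp hv (v x)] with y hy
  rw [hy, RCLike.inner_apply, inner_conj_symm, mul_comm]

theorem integralOperator_eq_setIntegral (hl : 0 ≤ l) (K : ℝ → ℝ → ℂ) (f : ℝ → ℂ) (x : ℝ) :
    integralOperator l K f x = ∫ y in Set.Icc 0 l, K x y * f y := by
  rw [integralOperator, intervalIntegral.integral_of_le hl, integral_Icc_eq_integral_Ioc]

/-- The integral operator with kernel `⟪v x, v y⟫` on `L²([0, l])`. -/
noncomputable def kernelOp (l : ℝ) (hv : Continuous v) : L2 l →L[ℂ] L2 l :=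
  (evalOp l hv).comp (ContinuousLinearMap.adjoint (evalOp l hv))

theorem coeFn_kernelOp (hl : 0 ≤ l) (hv : Continuous v) (f : L2 l) :
    kernelOp l hv f =ᵐ[(volume : Measure ℝ).restrict (Set.Icc 0 l)]
      integralOperator l (fun x y => ⟪v x, v y⟫_ℂ) f := by
  filter_upwards [coeFn_evalOp hv (ContinuousLinearMap.adjoint (evalOp l hv) f)] with x hx
  rw [kernelOp, ContinuousLinearMap.comp_apply, hx, inner_adjoint_evalOp,
    integralOperator_eq_setIntegral hl]

theorem isEigenvalueSequence_iff (hl : 0 ≤ l) (hv : Continuous v) (ev : ℕ → ℝ) :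
    IsEigenvalueSequence l (fun x y => ⟪v x, v y⟫_ℂ) ev ↔
      ∃ φ : ℕ → L2 l, Orthonormal ℂ φ ∧ (∀ k, kernelOp l hv (φ k) = (ev k : ℂ) • φ k) ∧
        ∀ f : L2 l, (∀ k, ⟪φ k, f⟫_ℂ = 0) → kernelOp l hv f = 0 := by
  refine exists_congr fun φ => and_congr_right fun _ => and_congr
    (forall_congr' fun k => ?_) (forall_congr' fun f => imp_congr_right fun _ => ?_)
  · rw [Lp.ext_iff]
    constructor
    · intro h
      filter_upwards [h, coeFn_kernelOp hl hv (φ k), Lp.coeFn_smul (ev k : ℂ) (φ k)]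
        with x h1 h2 h3
      rw [h2, h1, h3]; rfl
    · intro h
      filter_upwards [h, coeFn_kernelOp hl hv (φ k), Lp.coeFn_smul (ev k : ℂ) (φ k)]
        with x h1 h2 h3
      rw [← h2, h1, h3]; rfl
  · rw [Lp.ext_iff]
    constructor
    · intro h
      filter_upwards [h, coeFn_kernelOp hl hv f, Lp.coeFn_zero ℂ 2
        ((volume : Measure ℝ).restrict (Set.Icc 0 l))] with x h1 h2 h3
      rw [h2, h1, h3]; rfl
    · intro h
      filter_upwards [h, coeFn_kernelOp hl hv f, Lp.coeFn_zero ℂ 2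
        ((volume : Measure ℝ).restrict (Set.Icc 0 l))] with x h1 h2 h3
      rw [← h2, h1, h3]; rfl

theorem exists_isEigenvalueSequence (hl : 0 < l) (hv : Continuous v) :
    ∃ ev : ℕ → ℝ, IsEigenvalueSequence l (fun x y => ⟪v x, v y⟫_ℂ) ev := by
  have hcomp : IsCompactOperator (kernelOp l hv) :=
    (isCompactOperator_evalOp hv).comp_clm (ContinuousLinearMap.adjoint (evalOp l hv))
  have hsymm : (kernelOp l hv : L2 l →ₗ[ℂ] L2 l).IsSymmetric := by
    intro f g
    change ⟪evalOp l hv (ContinuousLinearMap.adjoint (evalOp l hv) f), g⟫_ℂ =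
      ⟪f, evalOp l hv (ContinuousLinearMap.adjoint (evalOp l hv) g)⟫_ℂ
    rw [← ContinuousLinearMap.adjoint_inner_right, ContinuousLinearMap.adjoint_inner_left]
  have : Fact ((2 : ENNReal) ≠ ⊤) := ⟨by norm_num⟩
  obtain ⟨φ, ev, h1, h2, h3⟩ := exists_orthonormal_eigenvectors
    (not_finiteDimensional_L2 hl) hcomp hsymm
  refine ⟨ev, (isEigenvalueSequence_iff hl.le hv ev).2 ⟨φ, h1, h2, fun f hf => ?_⟩⟩
  rw [h3 f hf, map_zero]

/-- The normalized image `ev⁻¹ᐟ² E* φ` in `H` of an eigenfunction `φ` with eigenvalue `ev`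
(zero if `ev = 0`). -/
noncomputable def featureVec (hv : Continuous v) (φ : ℕ → L2 l) (ev : ℕ → ℝ) (k : ℕ) : H :=
  (((√(ev k))⁻¹ : ℝ) : ℂ) • ContinuousLinearMap.adjoint (evalOp l hv) (φ k)

variable {φ : ℕ → L2 l} {ev : ℕ → ℝ}

theorem inner_adjoint_eigenvector (hv : Continuous v) (hφ : Orthonormal ℂ φ)
    (hev : ∀ k, kernelOp l hv (φ k) = (ev k : ℂ) • φ k) (j k : ℕ) :
    ⟪ContinuousLinearMap.adjoint (evalOp l hv) (φ j),
      ContinuousLinearMap.adjoint (evalOp l hv) (φ k)⟫_ℂ = if j = k then (ev k : ℂ) else 0 := by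
  rw [ContinuousLinearMap.adjoint_inner_left]
  change ⟪φ j, kernelOp l hv (φ k)⟫_ℂ = _
  rw [hev, inner_smul_right, orthonormal_iff_ite.1 hφ]
  simp

theorem eigenvalue_nonneg (hv : Continuous v) (hφ : Orthonormal ℂ φ)
    (hev : ∀ k, kernelOp l hv (φ k) = (ev k : ℂ) • φ k) (k : ℕ) : 0 ≤ ev k := by
  have h := inner_adjoint_eigenvector hv hφ hev k k
  have hn := inner_self_eq_norm_sq (𝕜 := ℂ) (ContinuousLinearMap.adjoint (evalOp l hv) (φ k))
  rw [h, if_pos rfl] at hn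
  have hn' : ev k = ‖ContinuousLinearMap.adjoint (evalOp l hv) (φ k)‖ ^ 2 := by simpa using hn
  rw [hn']; positivity

theorem inner_featureVec (hv : Continuous v) (hφ : Orthonormal ℂ φ)
    (hev : ∀ k, kernelOp l hv (φ k) = (ev k : ℂ) • φ k) (j k : ℕ) :
    ⟪featureVec hv φ ev j, featureVec hv φ ev k⟫_ℂ = if j = k ∧ ev k ≠ 0 then 1 else 0 := by
  rw [featureVec, featureVec, inner_smul_left, inner_smul_right,
    inner_adjoint_eigenvector hv hφ hev, Complex.conj_ofReal]
  by_cases hjk : j = k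
  · subst hjk
    by_cases h0 : ev j = 0
    · simp [h0]
    · have hs : (√(ev j))⁻¹ * ((√(ev j))⁻¹ * ev j) = 1 := by
        have hpos : 0 < ev j := lt_of_le_of_ne (eigenvalue_nonneg hv hφ hev j) (Ne.symm h0)
        have := Real.sqrt_pos.2 hpos
        nth_rewrite 3 [← Real.mul_self_sqrt hpos.le]
        field_simp
      simp only [if_true, true_and, ne_eq, h0, not_false_eq_true]
      exact_mod_cast hs
  · simp [hjk]

theorem evalOp_featureVec (hv : Continuous v) (hφ : Orthonormal ℂ φ)
    (hev : ∀ k, kernelOp l hv (φ k) = (ev k : ℂ) • φ k) (k : ℕ) :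
    evalOp l hv (featureVec hv φ ev k) = ((√(ev k) : ℝ) : ℂ) • φ k := by
  rw [featureVec, map_smul]
  change _ • kernelOp l hv (φ k) = _
  rw [hev, smul_smul]
  congr 1
  norm_cast
  nth_rewrite 2 [← Real.mul_self_sqrt (eigenvalue_nonneg hv hφ hev k)]
  by_cases h : √(ev k) = 0
  · simp [h]
  · field_simp

/-- The hypothesis makes `E g` orthogonal to every `φ k` (if `ev k = 0` then `E* φ k = 0`), so `E E*
E g = 0` and hence `E g = 0`. The function `⟪v x, g⟫` then vanishes almost everywhere and, being
continuous, at every point of `[0, l]`. -/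
theorem inner_eq_zero_of_forall_featureVec (hl : 0 < l) (hv : Continuous v)
    (hφ : Orthonormal ℂ φ) (hev : ∀ k, kernelOp l hv (φ k) = (ev k : ℂ) • φ k)
    (hker : ∀ f : L2 l, (∀ k, ⟪φ k, f⟫_ℂ = 0) → kernelOp l hv f = 0) {g : H}
    (hg : ∀ k, ev k ≠ 0 → ⟪featureVec hv φ ev k, g⟫_ℂ = 0) {x : ℝ} (hx : x ∈ Set.Icc 0 l) :
    ⟪v x, g⟫_ℂ = 0 := by
  have h1 : ∀ k, ⟪φ k, evalOp l hv g⟫_ℂ = 0 := by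
    intro k
    rw [← ContinuousLinearMap.adjoint_inner_left]
    by_cases h0 : ev k = 0
    · have h := inner_adjoint_eigenvector hv hφ hev k k
      rw [if_pos rfl, h0, Complex.ofReal_zero, inner_self_eq_zero] at h
      rw [h, inner_zero_left]
    · have h := hg k h0
      rw [featureVec, inner_smul_left, Complex.conj_ofReal, mul_eq_zero] at h
      refine h.resolve_left ?_
      have hpos : 0 < ev k := lt_of_le_of_ne (eigenvalue_nonneg hv hφ hev k) (Ne.symm h0)
      exact_mod_cast (inv_pos.2 (Real.sqrt_pos.2 hpos)).ne'
  have h2 := hker _ h1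
  have h3 : ContinuousLinearMap.adjoint (evalOp l hv) (evalOp l hv g) = 0 := by
    rw [← inner_self_eq_zero (𝕜 := ℂ), ContinuousLinearMap.adjoint_inner_left]
    change ⟪_, kernelOp l hv (evalOp l hv g)⟫_ℂ = 0
    rw [h2, inner_zero_right]
  have h4 : evalOp l hv g = 0 := by
    rw [← inner_self_eq_zero (𝕜 := ℂ), ← ContinuousLinearMap.adjoint_inner_left, h3,
      inner_zero_left]
  have h5 : (fun x => ⟪v x, g⟫_ℂ) =ᵐ[(volume : Measure ℝ).restrict (Set.Icc 0 l)] fun _ => 0 := by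
    have := coeFn_evalOp (l := l) hv g
    rw [h4] at this
    exact this.symm.trans (Lp.coeFn_zero ℂ 2 _)
  exact Measure.eqOn_Icc_of_ae_eq volume hl.ne h5 (continuous_inner_left hv g).continuousOn
    continuousOn_const hx

/-- Mercer's theorem for the kernel `⟪v x, v y⟫`. -/
theorem hasSum_mercer (hl : 0 < l) (hv : Continuous v)
    (hφ : Orthonormal ℂ φ) (hev : ∀ k, kernelOp l hv (φ k) = (ev k : ℂ) • φ k)
    (hker : ∀ f : L2 l, (∀ k, ⟪φ k, f⟫_ℂ = 0) → kernelOp l hv f = 0) {x y : ℝ}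
    (hx : x ∈ Set.Icc 0 l) :
    HasSum (fun k => ⟪v x, featureVec hv φ ev k⟫_ℂ * ⟪featureVec hv φ ev k, v y⟫_ℂ)
      ⟪v x, v y⟫_ℂ := by
  let S : Set ℕ := {k | ev k ≠ 0}
  have horth : Orthonormal ℂ (fun k : S => featureVec hv φ ev k) := by
    rw [orthonormal_iff_ite]
    rintro ⟨j, hj⟩ ⟨k, hk⟩
    rw [inner_featureVec hv hφ hev]
    have hk' : ev k ≠ 0 := hk
    simp [hk', Subtype.ext_iff]
  -- Parseval in a Hilbert basis of `H` extending the nonzero feature vectors: the added basis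
  -- vectors are orthogonal to `v x` and contribute nothing.
  obtain ⟨w, b, hsw, hb⟩ := horth.toSubtypeRange.exists_hilbertBasis_extension
  let j : S → w := fun k => ⟨featureVec hv φ ev k, hsw ⟨k, rfl⟩⟩
  have hj : Function.Injective j := fun k k' h =>
    horth.linearIndependent.injective (congrArg Subtype.val h)
  have hsum := b.hasSum_inner_mul_inner (v x) (v y)
  have hoff : ∀ i ∉ Set.range j, ⟪v x, b i⟫_ℂ * ⟪b i, v y⟫_ℂ = 0 := by
    intro i hi
    have : ⟪v x, b i⟫_ℂ = 0 := by
      refine inner_eq_zero_of_forall_featureVec hl hv hφ hev hker (fun k hk => ?_) hx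
      have hne : j ⟨k, hk⟩ ≠ i := fun h => hi ⟨_, h⟩
      have h := b.orthonormal.2 hne
      rw [hb] at h ⊢
      exact h
    rw [this, zero_mul]
  have h1 := (hj.hasSum_iff hoff).2 hsum
  have h2 : HasSum ((fun k => ⟪v x, featureVec hv φ ev k⟫_ℂ * ⟪featureVec hv φ ev k, v y⟫_ℂ) ∘
      ((↑) : S → ℕ)) ⟪v x, v y⟫_ℂ := by
    convert h1 using 1
    funext k
    simp [hb, j]
  refine (hasSum_subtype_iff_of_support_subset ?_).1 h2
  intro k hk
  by_contra hkS
  have hk0 : ev k = 0 := not_not.1 hkS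
  apply hk
  simp [featureVec, hk0]

/-- Bessel's inequality bounds the diagonal, and `2ab ≤ a² + b²` the rest. The bound is independent
of `N`, as dominated convergence requires. -/
theorem norm_sum_mercer_le (hl : 0 < l) (hv : Continuous v)
    (hφ : Orthonormal ℂ φ) (hev : ∀ k, kernelOp l hv (φ k) = (ev k : ℂ) • φ k)
    (hker : ∀ f : L2 l, (∀ k, ⟪φ k, f⟫_ℂ = 0) → kernelOp l hv f = 0) {M : ℝ}
    (hM : ∀ x ∈ Set.Icc 0 l, ‖v x‖ ≤ M) (N : ℕ) {x y : ℝ}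
    (hx : x ∈ Set.Icc 0 l) (hy : y ∈ Set.Icc 0 l) :
    ‖∑ k : Fin N, ⟪v x, featureVec hv φ ev k⟫_ℂ * ⟪featureVec hv φ ev k, v y⟫_ℂ‖ ≤ M ^ 2 := by
  have hdiag : ∀ x ∈ Set.Icc 0 l, ∑ k : Fin N, ‖⟪v x, featureVec hv φ ev k⟫_ℂ‖ ^ 2 ≤ M ^ 2 := by
    intro x hx
    have h := hasSum_mercer hl hv hφ hev hker (y := x) hx
    have h' : HasSum (fun k => ‖⟪v x, featureVec hv φ ev k⟫_ℂ‖ ^ 2) (‖v x‖ ^ 2) := by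
      rw [← Complex.hasSum_ofReal]
      convert h using 1
      · ext k
        rw [← inner_conj_symm (featureVec hv φ ev k) (v x), Complex.mul_conj']
        push_cast; rfl
      · rw [inner_self_eq_norm_sq_to_K]; push_cast; rfl
    rw [Fin.sum_univ_eq_sum_range (fun k => ‖⟪v x, featureVec hv φ ev k⟫_ℂ‖ ^ 2)]
    exact (sum_le_hasSum _ (fun _ _ => by positivity) h').trans
      (pow_le_pow_left₀ (norm_nonneg _) (hM x hx) 2)
  calc _ ≤ ∑ k : Fin N, (‖⟪v x, featureVec hv φ ev k⟫_ℂ‖ ^ 2 +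
        ‖⟪v y, featureVec hv φ ev k⟫_ℂ‖ ^ 2) / 2 := by
        refine norm_sum_le_of_le _ fun k _ => ?_
        rw [norm_mul, norm_inner_symm (featureVec hv φ ev k) (v y)]
        linarith [two_mul_le_add_sq ‖⟪v x, featureVec hv φ ev k⟫_ℂ‖
          ‖⟪v y, featureVec hv φ ev k⟫_ℂ‖]
    _ ≤ _ := by
        rw [← Finset.sum_div, Finset.sum_add_distrib]
        linarith [hdiag x hx, hdiag y hy]

/-- The Fredholm determinant of a positive kernel is the product over the eigenvalues. -/
theorem tendsto_prod_one_add_eigenvalue (hl : 0 < l) (hv : Continuous v)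
    (hφ : Orthonormal ℂ φ) (hev : ∀ k, kernelOp l hv (φ k) = (ev k : ℂ) • φ k)
    (hker : ∀ f : L2 l, (∀ k, ⟪φ k, f⟫_ℂ = 0) → kernelOp l hv f = 0) (z : ℂ) :
    Tendsto (fun N => ∏ k ∈ Finset.range N, (1 + z * ev k)) atTop
      (𝓝 (fredholmDet l (fun x y => ⟪v x, v y⟫_ℂ) z)) := by
  obtain ⟨M, hM0, hM⟩ := exists_norm_le_on_Icc l hv
  set e := featureVec hv φ ev
  have hconv := tendsto_fredholmDet hl.le (sq_nonneg M)
    (K := fun x y => ⟪v x, v y⟫_ℂ)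
    (KN := fun N x y => ∑ k : Fin N, ⟪v x, e k⟫_ℂ * ⟪e k, v y⟫_ℂ)
    (fun N => by
      refine continuous_finsetSum _ fun k _ => ?_
      exact ((hv.comp continuous_fst).inner continuous_const).mul
        (continuous_const.inner (hv.comp continuous_snd)))
    (fun N x hx y hy => norm_sum_mercer_le hl hv hφ hev hker hM N hx hy)
    (fun x hx y hy => by
      have h := (hasSum_mercer hl hv hφ hev hker (y := y) hx).tendsto_sum_nat
      refine h.congr fun N => ?_
      exact (Fin.sum_univ_eq_sum_range (fun k => ⟪v x, e k⟫_ℂ * ⟪e k, v y⟫_ℂ) N).symm) z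
  refine hconv.congr fun N => ?_
  have hfin := fredholmDet_finiteRank (l := l) (fun (k : Fin N) x => ⟪v x, e k⟫_ℂ)
    (fun (k : Fin N) y => ⟪e k, v y⟫_ℂ) (fun j k => by
      refine Continuous.integrableOn_Icc ?_
      exact (hv.inner continuous_const).mul (continuous_const.inner hv)) z
  rw [hfin]
  -- The entries are inner products of `E e j = √(ev j) φ j`, so orthonormality of `φ` makes the
  -- matrix diagonal.
  have hgram : (Matrix.of fun j k : Fin N =>
      ∫ x in Set.Icc 0 l, ⟪v x, e j⟫_ℂ * ⟪e k, v x⟫_ℂ) =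
        Matrix.diagonal fun k : Fin N => (ev k : ℂ) := by
    ext j k
    have h1 : ∫ x in Set.Icc 0 l, ⟪v x, e j⟫_ℂ * ⟪e k, v x⟫_ℂ =
        ⟪evalOp l hv (e k), evalOp l hv (e j)⟫_ℂ := by
      rw [L2.inner_def]
      refine integral_congr_ae ?_
      filter_upwards [coeFn_evalOp hv (e j), coeFn_evalOp hv (e k)] with x hx1 hx2
      rw [hx1, hx2, RCLike.inner_apply, inner_conj_symm]
    rw [Matrix.of_apply, h1, evalOp_featureVec hv hφ hev, evalOp_featureVec hv hφ hev,
      inner_smul_left, inner_smul_right, orthonormal_iff_ite.1 hφ, Matrix.diagonal_apply,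
      Complex.conj_ofReal]
    by_cases hjk : j = k
    · subst hjk
      simp only [if_true, mul_one]
      norm_cast
      exact Real.mul_self_sqrt (eigenvalue_nonneg hv hφ hev j)
    · rw [if_neg (fun h => hjk (Fin.ext h.symm)), if_neg hjk]; simp
  rw [hgram, ← Matrix.diagonal_one, ← Matrix.diagonal_smul, Matrix.diagonal_add,
    Matrix.det_diagonal]
  exact Fin.prod_univ_eq_prod_range (fun k => 1 + z * (ev k : ℂ)) N

end Mercer

end

end LinearAntenna

namespace LinearAntenna

section

open scoped InnerProductSpace
open MeasureTheory Filter Topology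

/-! ### Error of the midpoint rule. -/

section Midpoint

/-- The linear Taylor term integrates to zero over an interval symmetric about `c`; by the mean
value inequality the remainder is at most `M δ²` pointwise. -/
theorem norm_midpoint_cell_le {F F' : ℝ → ℂ} (hF : ∀ x, HasDerivAt F (F' x) x)
    {M c δ : ℝ} (hM : 0 ≤ M) (hδ : 0 ≤ δ)
    (hL : ∀ x ∈ Set.Icc (c - δ) (c + δ), ‖F' x - F' c‖ ≤ M * |x - c|) :
    ‖(∫ x in (c - δ)..(c + δ), F x) - (2 * δ : ℝ) * F c‖ ≤ 2 * M * δ ^ 3 := by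
  have hFc : Continuous F := continuous_iff_continuousAt.2 fun x => (hF x).continuousAt
  have hcmem : c ∈ Set.Icc (c - δ) (c + δ) := ⟨by linarith, by linarith⟩
  have hpt : ∀ x ∈ Set.Icc (c - δ) (c + δ),
      ‖F x - F c - ((x - c : ℝ) : ℂ) * F' c‖ ≤ M * δ ^ 2 := by
    intro x hx
    have hxc : |x - c| ≤ δ := abs_le.2 ⟨by linarith [hx.1], by linarith [hx.2]⟩
    have h := (convex_Icc (c - δ) (c + δ)).norm_image_sub_le_of_norm_hasDerivWithin_le
      (f := fun t => F t - (t : ℂ) * F' c) (f' := fun t => F' t - 1 * F' c) (C := M * δ)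
      (fun t _ => ((hF t).sub ((Complex.ofRealCLM.hasDerivAt (x := t)).mul_const
        (F' c))).hasDerivWithinAt)
      (fun t ht => by
        rw [one_mul]
        refine (hL t ht).trans (mul_le_mul_of_nonneg_left ?_ hM)
        exact abs_le.2 ⟨by linarith [ht.1], by linarith [ht.2]⟩) hcmem hx
    have he : F x - F c - ((x - c : ℝ) : ℂ) * F' c =
        (F x - (x : ℂ) * F' c) - (F c - (c : ℂ) * F' c) := by push_cast; ring
    rw [he]
    refine h.trans ?_
    rw [Real.norm_eq_abs]
    calc M * δ * |x - c| ≤ M * δ * δ := by gcongr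
      _ = M * δ ^ 2 := by ring
  have hint : (∫ x in (c - δ)..(c + δ), F x) - (2 * δ : ℝ) * F c =
      ∫ x in (c - δ)..(c + δ), (F x - F c - ((x - c : ℝ) : ℂ) * F' c) := by
    have h1 : ∫ x in (c - δ)..(c + δ), ((x - c : ℝ) : ℂ) * F' c = 0 := by
      rw [intervalIntegral.integral_mul_const, intervalIntegral.integral_ofReal]
      have : ∫ x in (c - δ)..(c + δ), (x - c) = 0 := by
        rw [intervalIntegral.integral_sub (by simp) (by simp), integral_id,
          intervalIntegral.integral_const, smul_eq_mul]
        ring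
      rw [this]; simp
    rw [intervalIntegral.integral_sub, intervalIntegral.integral_sub, h1,
      intervalIntegral.integral_const, sub_zero, Complex.real_smul]
    · congr 2; push_cast; ring
    · exact hFc.intervalIntegrable _ _
    · exact continuous_const.intervalIntegrable _ _
    · exact (hFc.sub continuous_const).intervalIntegrable _ _
    · exact Continuous.intervalIntegrable (by fun_prop) _ _
  rw [hint]
  have h := intervalIntegral.norm_integral_le_of_norm_le_const (a := c - δ) (b := c + δ)
    (f := fun x => F x - F c - ((x - c : ℝ) : ℂ) * F' c) (C := M * δ ^ 2) (fun x hx => by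
      rw [Set.uIoc_of_le (by linarith)] at hx
      exact hpt x ⟨hx.1.le, hx.2⟩)
  refine h.trans (le_of_eq ?_)
  rw [abs_of_nonneg (by linarith)]; ring

theorem antenna_mem_Icc {l : ℝ} (hl : 0 ≤ l) {m : ℕ} (i : Fin m) :
    antenna l m i ∈ Set.Icc 0 l := by
  have hm : (0 : ℝ) < m := by exact_mod_cast i.pos
  have hi : ((i : ℕ) : ℝ) + 1 ≤ m := by exact_mod_cast i.2
  refine ⟨by unfold antenna; positivity, ?_⟩
  rw [antenna, div_le_iff₀ hm, mul_comm]
  gcongr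
  linarith

/-- The error of the midpoint rule for a twice differentiable function. -/
theorem norm_midpoint_rule_le {l : ℝ} (hl : 0 ≤ l) {F F' F'' : ℝ → ℂ}
    (hF : ∀ x, HasDerivAt F (F' x) x) (hF' : ∀ x, HasDerivAt F' (F'' x) x) {M : ℝ} (hM : 0 ≤ M)
    (hb : ∀ x ∈ Set.Icc 0 l, ‖F'' x‖ ≤ M) {m : ℕ} (hm : 1 ≤ m) :
    ‖((l / m : ℝ) : ℂ) * (∑ i : Fin m, F (antenna l m i)) - ∫ x in (0 : ℝ)..l, F x‖ ≤
      M * l ^ 3 / m ^ 2 := by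
  have hm' : (0 : ℝ) < m := by exact_mod_cast hm
  have hFc : Continuous F := continuous_iff_continuousAt.2 fun x => (hF x).continuousAt
  set h := l / m with hh
  have hh0 : 0 ≤ h := by positivity
  have hmh : m * h = l := by rw [hh]; field_simp
  have hsum : ∫ x in (0 : ℝ)..l, F x =
      ∑ i ∈ Finset.range m, ∫ x in ((i : ℝ) * h)..(((i + 1 : ℕ) : ℝ) * h), F x := by
    rw [intervalIntegral.sum_integral_adjacent_intervals
      (a := fun i : ℕ => (i : ℝ) * h) fun k _ => hFc.intervalIntegrable _ _]
    simp [hmh]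
  have hant : ∀ i : ℕ, ((i : ℝ) + 1 / 2) * l / m = ((i : ℝ) + 1 / 2) * h := fun i => by
    rw [hh]; ring
  have hL : ∑ i : Fin m, F (antenna l m i) =
      ∑ i ∈ Finset.range m, F (((i : ℝ) + 1 / 2) * h) := by
    rw [← Fin.sum_univ_eq_sum_range (fun i => F (((i : ℝ) + 1 / 2) * h))]
    exact Finset.sum_congr rfl fun i _ => by rw [antenna, hant]
  rw [hL, hsum, Finset.mul_sum, ← Finset.sum_sub_distrib]
  have hcell : ∀ i ∈ Finset.range m,
      ‖(h : ℂ) * F (((i : ℝ) + 1 / 2) * h) -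
        ∫ x in ((i : ℝ) * h)..(((i + 1 : ℕ) : ℝ) * h), F x‖ ≤ 2 * M * (h / 2) ^ 3 := by
    intro i hi
    have him : ((i : ℕ) : ℝ) + 1 ≤ m := by exact_mod_cast Finset.mem_range.1 hi
    set c := ((i : ℝ) + 1 / 2) * h with hc
    have e1 : (i : ℝ) * h = c - h / 2 := by rw [hc]; ring
    have e2 : ((i + 1 : ℕ) : ℝ) * h = c + h / 2 := by rw [hc]; push_cast; ring
    have hsub : Set.Icc (c - h / 2) (c + h / 2) ⊆ Set.Icc 0 l := by
      refine Set.Icc_subset_Icc ?_ ?_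
      · rw [← e1]; positivity
      · rw [← e2, ← hmh]; push_cast; gcongr
    rw [e1, e2, norm_sub_rev]
    have := norm_midpoint_cell_le hF (c := c) (δ := h / 2) hM (by positivity) (fun x hx => by
      rw [← Real.norm_eq_abs]
      exact (convex_Icc (0 : ℝ) l).norm_image_sub_le_of_norm_hasDerivWithin_le
        (fun t _ => (hF' t).hasDerivWithinAt) hb
        (hsub ⟨by linarith, by linarith⟩) (hsub hx))
    rwa [mul_div_cancel₀ h (two_ne_zero)] at this
  refine (norm_sum_le_of_le _ hcell).trans ?_
  rw [Finset.sum_const, Finset.card_range, nsmul_eq_mul]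
  calc (m : ℝ) * (2 * M * (h / 2) ^ 3) = M * (m * h) * h ^ 2 / 4 := by ring
    _ ≤ M * (m * h) * h ^ 2 := by
        have : 0 ≤ M * (m * h) * h ^ 2 := by positivity
        linarith
    _ = M * l ^ 3 / m ^ 2 := by rw [hmh, hh]; ring

end Midpoint

/-! ### Symmetry, smoothness and nonvanishing of the Green's function. -/

section Green

/-- The Green's function in terms of the difference of the coordinates along the lines. -/
noncomputable def radialGreen (d wl Z₀ x : ℝ) : ℂ := green d wl Z₀ x 0

variable {d wl Z₀ : ℝ}

theorem green_eq (r s : ℝ) : green d wl Z₀ r s = radialGreen d wl Z₀ (r - s) := by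
  simp only [radialGreen, green, sub_zero]

/-- This reciprocity lets the antenna positions serve as quadrature nodes for the source integral.
-/
theorem radialGreen_neg (x : ℝ) : radialGreen d wl Z₀ (-x) = radialGreen d wl Z₀ x := by
  simp only [radialGreen, green, sub_zero, neg_sq]

theorem contDiff_radialGreen (hd : 0 < d) (hwl : 0 < wl) :
    ContDiff ℝ 2 (radialGreen d wl Z₀) := by
  have hpos : ∀ x : ℝ, 0 < x ^ 2 + d ^ 2 := fun x => by positivity
  have hof : ∀ {f : ℝ → ℝ}, ContDiff ℝ 2 f → ContDiff ℝ 2 fun x => (f x : ℂ) := fun hf =>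
    Complex.ofRealCLM.contDiff.comp hf
  have hden : ContDiff ℝ 2 fun x : ℝ => x ^ 2 + d ^ 2 := by fun_prop
  have hρ : ContDiff ℝ 2 fun x : ℝ => √(x ^ 2 + d ^ 2) := hden.sqrt fun x => (hpos x).ne'
  have hρ0 : ∀ x : ℝ, √(x ^ 2 + d ^ 2) ≠ 0 := fun x => (Real.sqrt_pos.2 (hpos x)).ne'
  have hq : ContDiff ℝ 2 fun x : ℝ => (d ^ 2 - 2 * x ^ 2) / (x ^ 2 + d ^ 2) :=
    ContDiff.div (by fun_prop) hden fun x => (hpos x).ne'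
  have hk : ContDiff ℝ 2 fun x : ℝ => 2 * Real.pi * √(x ^ 2 + d ^ 2) / wl :=
    (contDiff_const.mul hρ).div_const wl
  have hdiv : ∀ {f : ℝ → ℂ} {u : ℝ → ℝ}, ContDiff ℝ 2 f → ContDiff ℝ 2 u → (∀ x, u x ≠ 0) →
      ContDiff ℝ 2 fun x => f x / (u x : ℂ) := by
    intro f u hf hu h0
    simp only [div_eq_mul_inv]
    exact hf.mul ((hof hu).inv fun x => Complex.ofReal_ne_zero.2 (h0 x))
  have hk0 : ∀ x : ℝ, 2 * Real.pi * √(x ^ 2 + d ^ 2) / wl ≠ 0 := fun x => div_ne_zero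
    (mul_ne_zero (mul_ne_zero two_ne_zero Real.pi_ne_zero) (hρ0 x)) hwl.ne'
  have hamp : ContDiff ℝ 2 fun x : ℝ => Complex.I * (Z₀ : ℂ) *
      Complex.exp (Complex.I * ((2 * Real.pi * √(x ^ 2 + d ^ 2) / wl : ℝ) : ℂ)) :=
    contDiff_const.mul (contDiff_const.mul (hof hk)).cexp
  unfold radialGreen green
  simp only [sub_zero]
  refine ContDiff.mul (hdiv hamp (contDiff_const.mul hρ) fun x => ?_)
    (ContDiff.sub (ContDiff.add (ContDiff.mul (hdiv contDiff_const hk hk0) (hof hq)) (hof ?_))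
      (hof (ContDiff.mul ?_ hq)))
  · exact mul_ne_zero (mul_ne_zero two_ne_zero hwl.ne') (hρ0 x)
  · exact contDiff_const.div hden fun x => (hpos x).ne'
  · refine contDiff_const.div (contDiff_const.mul hden) fun x => ?_
    exact mul_ne_zero (pow_ne_zero _ (div_ne_zero
      (mul_ne_zero two_ne_zero Real.pi_ne_zero) hwl.ne')) (hpos x).ne'

/-- The bracket has imaginary part `q / a` and real part `p - b q`, with `p = d² / (x² + d²)`. If
the former vanishes then `q = 0`, and the latter is `p ≠ 0`. -/
theorem radialGreen_ne_zero (hd : 0 < d) (hwl : 0 < wl) (hZ₀ : 0 < Z₀) (x : ℝ) :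
    radialGreen d wl Z₀ x ≠ 0 := by
  have hbr : ∀ a b p q : ℝ, a ≠ 0 → p ≠ 0 →
      Complex.I / (a : ℂ) * (q : ℂ) + (p : ℂ) - ((b * q : ℝ) : ℂ) ≠ 0 := by
    intro a b p q ha hp h0
    have e : Complex.I / (a : ℂ) * (q : ℂ) + (p : ℂ) - ((b * q : ℝ) : ℂ) =
        ((p - b * q : ℝ) : ℂ) + ((q / a : ℝ) : ℂ) * Complex.I := by push_cast; ring
    rw [e] at h0
    have him := congrArg Complex.im h0
    have hre := congrArg Complex.re h0
    simp only [Complex.add_im, Complex.ofReal_im, Complex.mul_im, Complex.I_im, Complex.I_re,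
      Complex.ofReal_re, Complex.zero_im, Complex.add_re, Complex.mul_re, Complex.zero_re,
      mul_one, mul_zero, zero_add, add_zero, sub_zero] at him hre
    rcases div_eq_zero_iff.1 him with h | h
    · rw [h, mul_zero, sub_zero] at hre; exact hp hre
    · exact ha h
  have hpos : 0 < x ^ 2 + d ^ 2 := by positivity
  have hρ : 0 < √(x ^ 2 + d ^ 2) := Real.sqrt_pos.2 hpos
  unfold radialGreen green
  simp only [sub_zero]
  refine mul_ne_zero (div_ne_zero (mul_ne_zero (mul_ne_zero Complex.I_ne_zero ?_)
    (Complex.exp_ne_zero _)) ?_) (hbr _ _ _ _ ?_ ?_)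
  · exact_mod_cast hZ₀.ne'
  · exact_mod_cast (by positivity : (0 : ℝ) < 2 * wl * √(x ^ 2 + d ^ 2)).ne'
  · exact (by positivity : (0 : ℝ) < 2 * Real.pi * √(x ^ 2 + d ^ 2) / wl).ne'
  · positivity

end Green

/-! ### The autocorrelation kernel and its feature map. -/

section Convolution

/-- The autocorrelation kernel of a translation invariant Green's function `g (r - s)`. -/
noncomputable def autocorr (l P : ℝ) (g : ℝ → ℂ) (r r' : ℝ) : ℂ :=
  (P : ℂ) * ∫ s in (0 : ℝ)..l, g (r - s) * (starRingEnd ℂ) (g (r' - s))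

theorem fieldKernel_eq_autocorr (l d wl Z₀ P : ℝ) :
    fieldKernel l d wl Z₀ P = autocorr l P (radialGreen d wl Z₀) := by
  funext r r'
  simp only [fieldKernel, autocorr, green_eq]

variable {l P : ℝ} {g : ℝ → ℂ}

theorem continuous_autocorr (hg : Continuous g) : Continuous (Function.uncurry (autocorr l P g)) := by
  refine continuous_const.mul ?_
  refine intervalIntegral.continuous_parametric_intervalIntegral_of_continuous'
    (f := fun (p : ℝ × ℝ) s => g (p.1 - s) * (starRingEnd ℂ) (g (p.2 - s))) ?_ 0 l
  exact Continuous.mul (hg.comp (by fun_prop))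
    (Complex.continuous_conj.comp (hg.comp (by fun_prop)))

theorem memLp_feature (hg : Continuous g) (l P r : ℝ) :
    MemLp (fun s => ((√P : ℝ) : ℂ) * (starRingEnd ℂ) (g (r - s))) 2
      ((volume : Measure ℝ).restrict (Set.Icc 0 l)) :=
  memLp_two_of_continuous (continuous_const.mul
    (Complex.continuous_conj.comp (hg.comp (by fun_prop)))) l

/-- The feature map of the autocorrelation kernel. -/
noncomputable def feature (hg : Continuous g) (l P r : ℝ) : L2 l := (memLp_feature hg l P r).toLp

/-- The conjugate in the feature compensates the conjugate-linearity of the inner product in its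
first argument. -/
theorem inner_feature (hg : Continuous g) (hl : 0 ≤ l) (hP : 0 ≤ P) (r r' : ℝ) :
    ⟪feature hg l P r, feature hg l P r'⟫_ℂ = autocorr l P g r r' := by
  rw [L2.inner_def, autocorr, intervalIntegral.integral_of_le hl, ← integral_Icc_eq_integral_Ioc,
    ← integral_const_mul]
  refine integral_congr_ae ?_
  filter_upwards [MemLp.coeFn_toLp (memLp_feature hg l P r),
    MemLp.coeFn_toLp (memLp_feature hg l P r')] with s h1 h2
  rw [feature, feature, h1, h2, RCLike.inner_apply, map_mul, Complex.conj_conj,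
    Complex.conj_ofReal]
  have h : ((√P : ℝ) : ℂ) * ((√P : ℝ) : ℂ) = (P : ℂ) := by
    norm_cast; exact Real.mul_self_sqrt hP
  linear_combination (g (r - s) * (starRingEnd ℂ) (g (r' - s))) * h

/-- The squared distance of two features is a combination of kernel values, so continuity follows
from that of the kernel. -/
theorem continuous_feature (hg : Continuous g) (hl : 0 ≤ l) (hP : 0 ≤ P) :
    Continuous (feature hg l P) := by
  have hK := continuous_autocorr (l := l) (P := P) hg
  refine continuous_iff_continuousAt.2 fun r₀ => ?_
  rw [ContinuousAt, tendsto_iff_norm_sub_tendsto_zero]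
  have hsq : ∀ r, ‖feature hg l P r - feature hg l P r₀‖ =
      √((autocorr l P g r r).re - 2 * (autocorr l P g r r₀).re + (autocorr l P g r₀ r₀).re) := by
    intro r
    rw [← inner_feature hg hl hP, ← inner_feature hg hl hP, ← inner_feature hg hl hP,
      ← Real.sqrt_sq (norm_nonneg (feature hg l P r - feature hg l P r₀)), @norm_sub_sq ℂ]
    simp only [← inner_self_eq_norm_sq (𝕜 := ℂ)]
    rfl
  simp_rw [hsq]
  have hc : Continuous fun r => √((autocorr l P g r r).re - 2 * (autocorr l P g r r₀).re +
      (autocorr l P g r₀ r₀).re) := by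
    refine Real.continuous_sqrt.comp (Continuous.add (Continuous.sub ?_ (continuous_const.mul ?_))
      continuous_const)
    · exact Complex.continuous_re.comp
        (hK.comp (f := fun r : ℝ => (r, r)) (by fun_prop))
    · exact Complex.continuous_re.comp
        (hK.comp (f := fun r : ℝ => (r, r₀)) (by fun_prop))
  have h := hc.tendsto r₀
  have h0 : √((autocorr l P g r₀ r₀).re - 2 * (autocorr l P g r₀ r₀).re +
      (autocorr l P g r₀ r₀).re) = 0 := by
    rw [show (autocorr l P g r₀ r₀).re - 2 * (autocorr l P g r₀ r₀).re +
      (autocorr l P g r₀ r₀).re = 0 by ring, Real.sqrt_zero]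
  rwa [h0] at h

end Convolution

end

end LinearAntenna

namespace LinearAntenna

section

open scoped InnerProductSpace ComplexOrder
open MeasureTheory Filter Topology

/-! ### Antenna determinants as Fredholm determinants, and the rate `1 / m ^ 2`. -/

section Rate

variable {l P : ℝ} {g : ℝ → ℂ}

theorem exists_norm_sub_le (hg : Continuous g) (l : ℝ) :
    ∃ B : ℝ, 0 ≤ B ∧ ∀ x ∈ Set.Icc 0 l, ∀ y ∈ Set.Icc 0 l, ‖g (x - y)‖ ≤ B := by
  obtain ⟨B, hB⟩ := isCompact_Icc.exists_bound_of_continuousOn (s := Set.Icc (-l) l) hg.continuousOn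
  refine ⟨max B 0, le_max_right _ _, fun x hx y hy => (hB _ ⟨?_, ?_⟩).trans (le_max_left _ _)⟩
  · linarith [hx.1, hy.2]
  · linarith [hx.2, hy.1]

theorem exists_le_norm_sub (hl : 0 ≤ l) (hg : Continuous g) (hg0 : ∀ x, g x ≠ 0) :
    ∃ c : ℝ, 0 < c ∧ ∀ x ∈ Set.Icc 0 l, ∀ y ∈ Set.Icc 0 l, c ≤ ‖g (x - y)‖ := by
  obtain ⟨t, -, ht⟩ := isCompact_Icc.exists_isMinOn (s := Set.Icc (-l) l)
    ⟨0, by linarith, hl⟩ hg.norm.continuousOn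
  refine ⟨‖g t‖, norm_pos_iff.2 (hg0 t), fun x hx y hy => ht ⟨?_, ?_⟩⟩
  · linarith [hx.1, hy.2]
  · linarith [hx.2, hy.1]

/-- The midpoint rule for the autocorrelation kernel. -/
noncomputable def quadKernel (l P : ℝ) (g : ℝ → ℂ) (m : ℕ) (x y : ℝ) : ℂ :=
  (P : ℂ) * (((l / m : ℝ) : ℂ) *
    ∑ i : Fin m, g (x - antenna l m i) * (starRingEnd ℂ) (g (y - antenna l m i)))

theorem continuous_quadKernel (hg : Continuous g) (m : ℕ) :
    Continuous (Function.uncurry (quadKernel l P g m)) := by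
  refine continuous_const.mul (continuous_const.mul (continuous_finsetSum _ fun i _ => ?_))
  exact (hg.comp (by fun_prop)).mul (Complex.continuous_conj.comp (hg.comp (by fun_prop)))

theorem norm_quadKernel_le (hl : 0 ≤ l) (hP : 0 ≤ P) {B : ℝ} (hB0 : 0 ≤ B)
    (hB : ∀ x ∈ Set.Icc 0 l, ∀ y ∈ Set.Icc 0 l, ‖g (x - y)‖ ≤ B) {m : ℕ} (hm : 1 ≤ m) {x y : ℝ}
    (hx : x ∈ Set.Icc 0 l) (hy : y ∈ Set.Icc 0 l) :
    ‖quadKernel l P g m x y‖ ≤ P * (l * B ^ 2) := by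
  have hm' : (0 : ℝ) < m := by exact_mod_cast hm
  have hs : ‖∑ i : Fin m, g (x - antenna l m i) * (starRingEnd ℂ) (g (y - antenna l m i))‖ ≤
      m * B ^ 2 := by
    refine (norm_sum_le_of_le (f := fun i : Fin m =>
      g (x - antenna l m i) * (starRingEnd ℂ) (g (y - antenna l m i))) (n := fun _ => B ^ 2)
      _ fun i _ => ?_).trans (by simp)
    rw [norm_mul, RCLike.norm_conj, sq]
    exact mul_le_mul (hB _ hx _ (antenna_mem_Icc hl i)) (hB _ hy _ (antenna_mem_Icc hl i))
      (norm_nonneg _) hB0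
  rw [quadKernel, norm_mul, norm_mul, Complex.norm_real, Complex.norm_real,
    Real.norm_of_nonneg hP, Real.norm_of_nonneg (by positivity)]
  calc P * (l / m * _) ≤ P * (l / m * (m * B ^ 2)) := by gcongr
    _ = _ := by field_simp

theorem norm_autocorr_le (hl : 0 ≤ l) (hP : 0 ≤ P) {B : ℝ} (hB0 : 0 ≤ B)
    (hB : ∀ x ∈ Set.Icc 0 l, ∀ y ∈ Set.Icc 0 l, ‖g (x - y)‖ ≤ B) {x y : ℝ}
    (hx : x ∈ Set.Icc 0 l) (hy : y ∈ Set.Icc 0 l) :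
    ‖autocorr l P g x y‖ ≤ P * (l * B ^ 2) := by
  rw [autocorr, norm_mul, Complex.norm_real, Real.norm_of_nonneg hP]
  have h := intervalIntegral.norm_integral_le_of_norm_le_const (a := 0) (b := l)
    (f := fun s => g (x - s) * (starRingEnd ℂ) (g (y - s))) (C := B ^ 2) (fun s hs => by
      rw [Set.uIoc_of_le hl] at hs
      have hs' : s ∈ Set.Icc 0 l := ⟨hs.1.le, hs.2⟩
      rw [norm_mul, RCLike.norm_conj, sq]
      exact mul_le_mul (hB _ hx _ hs') (hB _ hy _ hs') (norm_nonneg _) hB0)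
  rw [sub_zero, abs_of_nonneg hl, mul_comm] at h
  gcongr

theorem le_re_autocorr_self (hl : 0 ≤ l) (hP : 0 ≤ P) (hg : Continuous g) {c : ℝ} (hc0 : 0 ≤ c)
    (hc : ∀ x ∈ Set.Icc 0 l, ∀ y ∈ Set.Icc 0 l, c ≤ ‖g (x - y)‖) {x : ℝ}
    (hx : x ∈ Set.Icc 0 l) : P * (l * c ^ 2) ≤ (autocorr l P g x x).re := by
  have h1 : autocorr l P g x x = ((P * ∫ s in (0 : ℝ)..l, ‖g (x - s)‖ ^ 2 : ℝ) : ℂ) := by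
    rw [autocorr, Complex.ofReal_mul, ← intervalIntegral.integral_ofReal]
    congr 1
    refine intervalIntegral.integral_congr fun s _ => ?_
    simp only [Complex.mul_conj']
    push_cast; rfl
  rw [h1, Complex.ofReal_re]
  have h2 : ∫ _s in (0 : ℝ)..l, c ^ 2 ≤ ∫ s in (0 : ℝ)..l, ‖g (x - s)‖ ^ 2 := by
    refine intervalIntegral.integral_mono_on hl (by simp)
      (Continuous.intervalIntegrable ((hg.comp (by fun_prop)).norm.pow 2) _ _) fun s hs => ?_
    exact pow_le_pow_left₀ hc0 (hc _ hx _ hs) 2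
  rw [intervalIntegral.integral_const, sub_zero, smul_eq_mul] at h2
  gcongr

theorem exists_norm_quadKernel_sub_le (hl : 0 ≤ l) (hP : 0 ≤ P) (hg : ContDiff ℝ 2 g) :
    ∃ C : ℝ, 0 ≤ C ∧ ∀ m : ℕ, 1 ≤ m → ∀ x ∈ Set.Icc 0 l, ∀ y ∈ Set.Icc 0 l,
      ‖quadKernel l P g m x y - autocorr l P g x y‖ ≤ C / m ^ 2 := by
  have hg1 : ContDiff ℝ 1 (deriv g) := by
    have : ContDiff ℝ (1 + 1) g := by norm_num; exact hg
    exact (contDiff_succ_iff_deriv.1 this).2.2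
  have hg2 : Continuous (deriv (deriv g)) := hg1.continuous_deriv le_rfl
  have hd : ∀ x, HasDerivAt g (deriv g x) x := fun x =>
    (hg.differentiable (by norm_num)).differentiableAt.hasDerivAt
  have hd1 : ∀ x, HasDerivAt (deriv g) (deriv (deriv g) x) x := fun x =>
    (hg1.differentiable (by norm_num)).differentiableAt.hasDerivAt
  obtain ⟨B0, hB00, hB0⟩ := exists_norm_sub_le hg.continuous l
  obtain ⟨B1, hB10, hB1⟩ := exists_norm_sub_le hg1.continuous l
  obtain ⟨B2, hB20, hB2⟩ := exists_norm_sub_le hg2 l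
  -- The product rule for the second derivative of `g (x - t)` times the conjugate of `g (y - t)`
  -- gives this constant. Bounds on `[-l, l]` make it uniform in `x` and `y`.
  refine ⟨P * ((B2 * B0 + 2 * (B1 * B1) + B0 * B2) * l ^ 3), by positivity, ?_⟩
  intro m hm x hx y hy
  have hsub : ∀ {f f' : ℝ → ℂ}, (∀ t, HasDerivAt f (f' t) t) → ∀ a t : ℝ,
      HasDerivAt (fun t => f (a - t)) (-f' (a - t)) t := by
    intro f f' hf a t
    have h := (hf (a - t)).scomp t ((hasDerivAt_id t).const_sub a)
    simpa using! h
  have hconj : ∀ {f f' : ℝ → ℂ}, (∀ t, HasDerivAt f (f' t) t) → ∀ t,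
      HasDerivAt (fun t => (starRingEnd ℂ) (f t)) ((starRingEnd ℂ) (f' t)) t := by
    intro f f' hf t
    exact Complex.conjCLE.toContinuousLinearMap.hasFDerivAt.comp_hasDerivAt t (hf t)
  have h0 := fun a => hsub hd a
  have h1 := fun a => hsub hd1 a
  have h := norm_midpoint_rule_le hl
    (F := fun t => g (x - t) * (starRingEnd ℂ) (g (y - t)))
    (F' := fun t => -deriv g (x - t) * (starRingEnd ℂ) (g (y - t)) +
      g (x - t) * (starRingEnd ℂ) (-deriv g (y - t)))
    (F'' := fun t => (-(-deriv (deriv g) (x - t)) * (starRingEnd ℂ) (g (y - t)) +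
        -deriv g (x - t) * (starRingEnd ℂ) (-deriv g (y - t))) +
      (-deriv g (x - t) * (starRingEnd ℂ) (-deriv g (y - t)) +
        g (x - t) * (starRingEnd ℂ) (-(-deriv (deriv g) (y - t)))))
    (fun t => (h0 x t).mul (hconj (h0 y) t))
    (fun t => ((h1 x t).neg.mul (hconj (h0 y) t)).add
      ((h0 x t).mul (hconj (fun t => (h1 y t).neg) t)))
    (M := B2 * B0 + 2 * (B1 * B1) + B0 * B2) (by positivity)
    (fun t ht => by
      refine (norm_add_le_of_le (norm_add_le_of_le (r₁ := B2 * B0) (r₂ := B1 * B1) ?_ ?_)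
        (norm_add_le_of_le (r₁ := B1 * B1) (r₂ := B0 * B2) ?_ ?_)).trans (by linarith) <;>
      · rw [norm_mul, RCLike.norm_conj]
        simp only [norm_neg]
        refine mul_le_mul ?_ ?_ (norm_nonneg _) ?_ <;>
        first
          | exact hB0 _ hx _ ht | exact hB0 _ hy _ ht | exact hB1 _ hx _ ht | exact hB1 _ hy _ ht
          | exact hB2 _ hx _ ht | exact hB2 _ hy _ ht | assumption) hm
  rw [quadKernel, autocorr, ← mul_sub, norm_mul, Complex.norm_real, Real.norm_of_nonneg hP,
    mul_div_assoc]
  gcongr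

theorem integral_mul_conj_of_even (hl : 0 ≤ l) (hge : ∀ x, g (-x) = g x) (a b : ℝ) :
    ∫ s in Set.Icc 0 l, ((P : ℂ) * g (s - a)) * (starRingEnd ℂ) (g (s - b)) =
      autocorr l P g a b := by
  rw [autocorr, intervalIntegral.integral_of_le hl, ← integral_Icc_eq_integral_Ioc,
    ← integral_const_mul]
  refine integral_congr_ae (Eventually.of_forall fun s => ?_)
  simp only
  rw [← hge (s - a), ← hge (s - b), neg_sub, neg_sub, mul_assoc]

/-- The determinant of the autocorrelation matrix of the antennas is a Fredholm determinant. -/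
theorem det_one_add_autocorr_eq (hl : 0 < l) (hg : Continuous g) (hge : ∀ x, g (-x) = g x)
    {m : ℕ} (hm : 1 ≤ m) (w : ℂ) :
    (1 + w • Matrix.of fun i j : Fin m =>
      autocorr l P g (antenna l m i) (antenna l m j)).det =
    fredholmDet l (fun x y => (w * ((m / l : ℝ) : ℂ)) * quadKernel l P g m x y) 1 := by
  have hm' : (m : ℂ) ≠ 0 := by exact_mod_cast (Nat.one_le_iff_ne_zero.1 hm)
  have hl' : (l : ℂ) ≠ 0 := by exact_mod_cast hl.ne'
  -- The factors are centred at the antennas. By evenness their Gram matrix is the autocorrelation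
  -- matrix, while the finite-rank kernel is `m / l` times `quadKernel`.
  have h := fredholmDet_finiteRank (l := l)
    (fun (k : Fin m) x => (P : ℂ) * g (x - antenna l m k))
    (fun (k : Fin m) y => (starRingEnd ℂ) (g (y - antenna l m k))) (fun j k => by
      refine Continuous.integrableOn_Icc ?_
      exact (continuous_const.mul (hg.comp (by fun_prop))).mul
        (Complex.continuous_conj.comp (hg.comp (by fun_prop)))) w
  simp only [integral_mul_conj_of_even hl.le hge] at h
  rw [← h, ← fredholmDet_smul]
  congr 1
  funext x y
  rw [quadKernel]
  simp only [mul_assoc (P : ℂ), ← Finset.mul_sum]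
  push_cast
  field_simp

/-- The matrix is a Gram matrix, so all its principal minors are nonnegative, and the zeroth term of
its Fredholm series is 1. In the order of `ℂ` the inequality also says that the determinant is real.
-/
theorem one_le_det_one_add_autocorr (hl : 0 ≤ l) (hP : 0 ≤ P) (hg : Continuous g) {m : ℕ}
    (r : Fin m → ℝ) {w : ℝ} (hw : 0 ≤ w) :
    1 ≤ (1 + (w : ℂ) • Matrix.of fun i j : Fin m => autocorr l P g (r i) (r j)).det := by
  have hpsd : (Matrix.of fun i j : Fin m => autocorr l P g (r i) (r j)).PosSemidef := by
    have heq : (Matrix.of fun i j : Fin m => autocorr l P g (r i) (r j)) =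
        Matrix.gram ℂ fun i : Fin m => feature hg l P (r i) := by
      ext i j
      rw [Matrix.gram_apply, inner_feature hg hl hP, Matrix.of_apply]
    rw [heq]
    exact Matrix.posSemidef_gram ℂ _
  have h := hasSum_det_submatrix (Matrix.of fun i j : Fin m => autocorr l P g (r i) (r j)) (w : ℂ)
  have h0 := le_hasSum h 0 fun n _ => mul_nonneg (by
      have : (w : ℂ) ^ n / (n.factorial : ℂ) = ((w ^ n / n.factorial : ℝ) : ℂ) := by push_cast; rfl
      rw [this]
      exact Complex.zero_le_real.2 (by positivity))
    (Finset.sum_nonneg fun f _ => (hpsd.submatrix f).det_nonneg)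
  simpa using h0

/-- The sum of the autocorrelations at the antennas converges to the integral. -/
theorem abs_sum_autocorr_sub_le (hl : 0 ≤ l) (hg : Continuous g) (hge : ∀ x, g (-x) = g x)
    {m : ℕ} {ε : ℝ}
    (hε : ∀ x ∈ Set.Icc 0 l, ‖quadKernel l P g m x x - autocorr l P g x x‖ ≤ ε) :
    |(l / m) * (∑ i : Fin m, (autocorr l P g (antenna l m i) (antenna l m i)).re) -
      ∫ r in (0 : ℝ)..l, (autocorr l P g r r).re| ≤ ε * l := by
  have hcK : Continuous fun r => autocorr l P g r r :=
    (continuous_autocorr (l := l) (P := P) hg).comp (f := fun r : ℝ => (r, r)) (by fun_prop)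
  have hcQ : Continuous fun r => quadKernel l P g m r r :=
    (continuous_quadKernel (l := l) (P := P) hg m).comp (f := fun r : ℝ => (r, r)) (by fun_prop)
  -- By evenness the Riemann sum of the diagonal equals the trace of `quadKernel` exactly, so the
  -- kernel estimate `ε` can be reused.
  have h1 : ∫ s in (0 : ℝ)..l, quadKernel l P g m s s =
      ((l / m : ℝ) : ℂ) * ∑ i : Fin m, autocorr l P g (antenna l m i) (antenna l m i) := by
    have hq : ∀ s, quadKernel l P g m s s = ((l / m : ℝ) : ℂ) * ∑ i : Fin m,
        ((P : ℂ) * g (s - antenna l m i)) * (starRingEnd ℂ) (g (s - antenna l m i)) := by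
      intro s
      rw [quadKernel, mul_left_comm, Finset.mul_sum]
      simp only [mul_assoc]
    simp only [hq]
    rw [intervalIntegral.integral_const_mul, intervalIntegral.integral_finsetSum]
    · congr 1
      refine Finset.sum_congr rfl fun i _ => ?_
      rw [intervalIntegral.integral_of_le hl, ← integral_Icc_eq_integral_Ioc,
        integral_mul_conj_of_even hl hge]
    · intro i _
      refine Continuous.intervalIntegrable ?_ _ _
      exact (continuous_const.mul (hg.comp (by fun_prop))).mul
        (Complex.continuous_conj.comp (hg.comp (by fun_prop)))
  have h2 : ∫ r in (0 : ℝ)..l, (autocorr l P g r r).re =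
      (∫ r in (0 : ℝ)..l, autocorr l P g r r).re :=
    Complex.reCLM.intervalIntegral_comp_comm (hcK.intervalIntegrable _ _)
  have h3 : (l / m) * (∑ i : Fin m, (autocorr l P g (antenna l m i) (antenna l m i)).re) =
      (∫ s in (0 : ℝ)..l, quadKernel l P g m s s).re := by
    rw [h1, Complex.re_ofReal_mul, Complex.re_sum]
  rw [h2, h3, ← Complex.sub_re, ← intervalIntegral.integral_sub (hcQ.intervalIntegrable _ _)
    (hcK.intervalIntegrable _ _)]
  refine (Complex.abs_re_le_norm _).trans ?_
  have h := intervalIntegral.norm_integral_le_of_norm_le_const (a := 0) (b := l)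
    (f := fun r => quadKernel l P g m r r - autocorr l P g r r) (C := ε) (fun s hs => by
      rw [Set.uIoc_of_le hl] at hs
      exact hε s ⟨hs.1.le, hs.2⟩)
  rwa [sub_zero, abs_of_nonneg hl] at h

/-- The noise power that makes the signal to noise ratio of `m` antennas equal to that of the
continuous receiver. -/
noncomputable def controlledNoise (l P n₀ : ℝ) (g : ℝ → ℂ) (m : ℕ) : ℝ :=
  n₀ * (∑ i : Fin m, (autocorr l P g (antenna l m i) (antenna l m i)).re)
    / ∫ r in (0 : ℝ)..l, (autocorr l P g r r).re

theorem integral_re_autocorr_pos (hl : 0 < l) (hP : 0 < P) (hg : Continuous g)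
    (hg0 : ∀ x, g x ≠ 0) : 0 < ∫ r in (0 : ℝ)..l, (autocorr l P g r r).re := by
  obtain ⟨c, hc0, hc⟩ := exists_le_norm_sub hl.le hg hg0
  refine intervalIntegral.intervalIntegral_pos_of_pos_on ?_ (fun x hx => ?_) hl
  · exact (Complex.continuous_re.comp ((continuous_autocorr (l := l) (P := P) hg).comp
      (f := fun r : ℝ => (r, r)) (by fun_prop))).intervalIntegrable _ _
  · exact lt_of_lt_of_le (by positivity)
      (le_re_autocorr_self hl.le hP.le hg hc0.le hc (Set.Ioo_subset_Icc_self hx))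

theorem sum_re_autocorr_pos (hl : 0 < l) (hP : 0 < P) (hg : Continuous g)
    (hg0 : ∀ x, g x ≠ 0) {m : ℕ} (hm : 1 ≤ m) :
    0 < ∑ i : Fin m, (autocorr l P g (antenna l m i) (antenna l m i)).re := by
  obtain ⟨c, hc0, hc⟩ := exists_le_norm_sub hl.le hg hg0
  refine Finset.sum_pos (fun i _ => ?_) ⟨⟨0, hm⟩, Finset.mem_univ _⟩
  exact lt_of_lt_of_le (by positivity)
    (le_re_autocorr_self hl.le hP.le hg hc0.le hc (antenna_mem_Icc hl.le i))

theorem controlledNoise_pos (hl : 0 < l) (hP : 0 < P) (hg : Continuous g)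
    (hg0 : ∀ x, g x ≠ 0) {n₀ : ℝ} (hn₀ : 0 < n₀) {m : ℕ} (hm : 1 ≤ m) :
    0 < controlledNoise l P n₀ g m :=
  div_pos (mul_pos hn₀ (sum_re_autocorr_pos hl hP hg hg0 hm))
    (integral_re_autocorr_pos hl hP hg hg0)

/-- With the noise power given by the SNR control rule, the determinants of the discrete receivers
converge with rate `1 / m ^ 2`. -/
theorem exists_norm_det_sub_fredholmDet_le (hl : 0 < l) (hP : 0 < P) (hg : ContDiff ℝ 2 g)
    (hge : ∀ x, g (-x) = g x) (hg0 : ∀ x, g x ≠ 0) {n₀ : ℝ} (hn₀ : 0 < n₀) :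
    ∃ C : ℝ, ∀ m : ℕ, 1 ≤ m →
      ‖(1 + ((1 / (controlledNoise l P n₀ g m / 2) : ℝ) : ℂ) • Matrix.of fun i j : Fin m =>
          autocorr l P g (antenna l m i) (antenna l m j)).det -
        fredholmDet l (autocorr l P g) ((1 / (n₀ / 2) : ℝ) : ℂ)‖ ≤ C / m ^ 2 := by
  have hgc := hg.continuous
  obtain ⟨C₁, hC₁, hquad⟩ := exists_norm_quadKernel_sub_le hl.le hP.le hg
  obtain ⟨B, hB0, hB⟩ := exists_norm_sub_le hgc l
  obtain ⟨c, hc0, hc⟩ := exists_le_norm_sub hl.le hgc hg0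
  set τ := ∫ r in (0 : ℝ)..l, (autocorr l P g r r).re with hτ
  have hτ0 : 0 < τ := integral_re_autocorr_pos hl hP hgc hg0
  set z : ℝ := 1 / (n₀ / 2) with hz
  have hz0 : 0 < z := by positivity
  set κ := P * (l * B ^ 2) with hκ
  have hκ0 : 0 ≤ κ := by positivity
  -- `τ₀` bounds `(l / m) σ` below for every `m`, by the positive minimum of `‖g‖`; `D / m ^ 2` will
  -- bound the shift of the spectral parameter.
  set τ₀ := l * (P * (l * c ^ 2)) with hτ₀
  have hτ₀0 : 0 < τ₀ := by positivity
  set D := z * (C₁ * l) / τ₀ with hD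
  have hD0 : 0 ≤ D := by positivity
  obtain ⟨C, hC0, hC⟩ := exists_norm_fredholmDet_sub_le hl.le
    (M := (z + D) * κ) (by positivity)
  refine ⟨C * ((z + D) * C₁ + D * κ), fun m hm => ?_⟩
  have hm' : (0 : ℝ) < m := by exact_mod_cast hm
  have hm1 : (1 : ℝ) ≤ m := by exact_mod_cast hm
  set σ := ∑ i : Fin m, (autocorr l P g (antenna l m i) (antenna l m i)).re with hσ
  have hσ0 : 0 < σ := sum_re_autocorr_pos hl hP hgc hg0 hm
  have hσle : m * (P * (l * c ^ 2)) ≤ σ := by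
    have := Finset.card_nsmul_le_sum Finset.univ
      (fun i : Fin m => (autocorr l P g (antenna l m i) (antenna l m i)).re) (P * (l * c ^ 2))
      (fun i _ => le_re_autocorr_self hl.le hP.le hgc hc0.le hc (antenna_mem_Icc hl.le i))
    simpa using this
  -- The effective parameter `(2 / n₁) (m / l)`: the noise rule turns it into `z` times a ratio of
  -- two traces.
  set zm : ℝ := z * τ / (l / m * σ) with hzm
  have hτm : τ₀ ≤ l / m * σ := by
    calc τ₀ = l / m * (m * (P * (l * c ^ 2))) := by rw [hτ₀]; field_simp
      _ ≤ _ := by gcongr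
  have hτm0 : 0 < l / m * σ := by positivity
  have hzm0 : 0 ≤ zm := by positivity
  have hdiff : |zm - z| ≤ D / m ^ 2 := by
    have h := abs_sum_autocorr_sub_le (P := P) hl.le hgc hge (m := m) (ε := C₁ / m ^ 2)
      (fun x hx => hquad m hm x hx x hx)
    have e : zm - z = z * (-(l / m * σ - τ)) / (l / m * σ) := by
      rw [hzm]; field_simp; ring
    rw [e, abs_div, abs_mul, abs_neg, abs_of_pos hz0, abs_of_pos hτm0]
    calc z * |l / m * σ - τ| / (l / m * σ) ≤ z * (C₁ / m ^ 2 * l) / τ₀ := by gcongr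
      _ = D / m ^ 2 := by rw [hD]; ring
  have hDm : D / (m : ℝ) ^ 2 ≤ D := div_le_self hD0 (one_le_pow₀ hm1)
  have hzmle : zm ≤ z + D := by linarith [(abs_le.1 hdiff).2]
  have hw : (((1 / (controlledNoise l P n₀ g m / 2) : ℝ) : ℂ) * ((m / l : ℝ) : ℂ)) = (zm : ℂ) := by
    rw [← Complex.ofReal_mul]
    congr 1
    rw [controlledNoise, ← hσ, ← hτ, hzm, hz]
    field_simp
  rw [det_one_add_autocorr_eq hl hgc hge hm, hw, ← fredholmDet_smul l (autocorr l P g)]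
  have hbK : ∀ x ∈ Set.Icc 0 l, ∀ y ∈ Set.Icc 0 l, ‖autocorr l P g x y‖ ≤ κ :=
    fun x hx y hy => norm_autocorr_le hl.le hP.le hB0 hB hx hy
  have hbQ : ∀ x ∈ Set.Icc 0 l, ∀ y ∈ Set.Icc 0 l, ‖quadKernel l P g m x y‖ ≤ κ :=
    fun x hx y hy => norm_quadKernel_le hl.le hP.le hB0 hB hm hx hy
  have h := hC (fun x y => (zm : ℂ) * quadKernel l P g m x y)
    (fun x y => (z : ℂ) * autocorr l P g x y) (((z + D) * C₁ + D * κ) / m ^ 2) (by positivity)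
    (continuous_const.mul (continuous_quadKernel hgc m))
    (continuous_const.mul (continuous_autocorr hgc))
    (fun x hx y hy => by
      rw [norm_mul, Complex.norm_real, Real.norm_of_nonneg hzm0]
      exact mul_le_mul hzmle (hbQ x hx y hy) (norm_nonneg _) (by positivity))
    (fun x hx y hy => by
      rw [norm_mul, Complex.norm_real, Real.norm_of_nonneg hz0.le]
      exact mul_le_mul (by linarith) (hbK x hx y hy) (norm_nonneg _) (by positivity))
    (fun x hx y hy => by
      have e : (zm : ℂ) * quadKernel l P g m x y - (z : ℂ) * autocorr l P g x y =
          (zm : ℂ) * (quadKernel l P g m x y - autocorr l P g x y) +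
            ((zm - z : ℝ) : ℂ) * autocorr l P g x y := by push_cast; ring
      rw [e]
      refine (norm_add_le _ _).trans ?_
      rw [norm_mul, norm_mul, Complex.norm_real, Complex.norm_real, Real.norm_of_nonneg hzm0,
        Real.norm_eq_abs]
      calc zm * ‖quadKernel l P g m x y - autocorr l P g x y‖ + |zm - z| * ‖autocorr l P g x y‖
          ≤ (z + D) * (C₁ / m ^ 2) + D / m ^ 2 * κ := by
            gcongr
            · exact hquad m hm x hx y hy
            · exact hbK x hx y hy
        _ = _ := by ring)
  refine h.trans (le_of_eq (by ring))

theorem abs_log_sub_log_le {a b : ℝ} (ha : 1 ≤ a) (hb : 1 ≤ b) :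
    |Real.log a - Real.log b| ≤ |a - b| := by
  have key : ∀ {a b : ℝ}, 1 ≤ a → 1 ≤ b → Real.log a - Real.log b ≤ |a - b| := by
    intro a b ha hb
    rw [← Real.log_div (by linarith) (by linarith)]
    refine (Real.log_le_sub_one_of_pos (by positivity)).trans ?_
    rw [div_sub_one (by linarith)]
    exact (div_le_div_of_nonneg_right (le_abs_self _) (by linarith)).trans
      (div_le_self (abs_nonneg _) hb)
  refine abs_le.2 ⟨?_, key ha hb⟩
  have := key hb ha
  rw [abs_sub_comm] at this
  linarith

end Rate

/-! ### Positivity and logarithm of the Fredholm determinant of a positive kernel. -/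

section Main

variable {H : Type*} [NormedAddCommGroup H] [InnerProductSpace ℂ H] [CompleteSpace H]
  {l : ℝ} {v : ℝ → H}

theorem tendsto_prod_one_add_of_isEigenvalueSequence (hl : 0 < l) (hv : Continuous v)
    {ev : ℕ → ℝ} (h : IsEigenvalueSequence l (fun x y => ⟪v x, v y⟫_ℂ) ev) :
    (∀ k, 0 ≤ ev k) ∧ ∀ z : ℝ, Tendsto
      (fun N => ((∏ k ∈ Finset.range N, (1 + z * ev k) : ℝ) : ℂ)) atTop
      (𝓝 (fredholmDet l (fun x y => ⟪v x, v y⟫_ℂ) z)) := by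
  obtain ⟨φ, hφ, hev, hker⟩ := (isEigenvalueSequence_iff hl.le hv ev).1 h
  refine ⟨eigenvalue_nonneg hv hφ hev, fun z => ?_⟩
  have := tendsto_prod_one_add_eigenvalue hl hv hφ hev hker (z : ℂ)
  push_cast
  exact this

/-- The determinant is a limit of real products all of whose factors are at least 1. -/
theorem one_le_fredholmDet (hl : 0 < l) (hv : Continuous v) {z : ℝ} (hz : 0 ≤ z) :
    (fredholmDet l (fun x y => ⟪v x, v y⟫_ℂ) z).im = 0 ∧
      1 ≤ (fredholmDet l (fun x y => ⟪v x, v y⟫_ℂ) z).re := by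
  obtain ⟨ev, hev⟩ := exists_isEigenvalueSequence hl hv
  obtain ⟨h0, ht⟩ := tendsto_prod_one_add_of_isEigenvalueSequence hl hv hev
  constructor
  · refine tendsto_nhds_unique ((Complex.continuous_im.tendsto _).comp (ht z)) ?_
    simp only [Function.comp_def, Complex.ofReal_im]
    exact tendsto_const_nhds
  · refine ge_of_tendsto ((Complex.continuous_re.tendsto _).comp (ht z))
      (Eventually.of_forall fun N => ?_)
    simp only [Function.comp_def, Complex.ofReal_re]
    refine (Finset.prod_const_one (M := ℝ)).symm.le.trans (Finset.prod_le_prod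
      (s := Finset.range N) (fun _ _ => zero_le_one) fun k _ => ?_)
    nlinarith [mul_nonneg hz (h0 k)]

/-- The logarithm of the Fredholm determinant in terms of the eigenvalues. -/
theorem hasSum_log_one_add_eigenvalue (hl : 0 < l) (hv : Continuous v) {ev : ℕ → ℝ}
    (h : IsEigenvalueSequence l (fun x y => ⟪v x, v y⟫_ℂ) ev) {z : ℝ} (hz : 0 ≤ z) :
    HasSum (fun k => Real.log (1 + z * ev k))
      (Real.log (fredholmDet l (fun x y => ⟪v x, v y⟫_ℂ) z).re) := by
  obtain ⟨h0, ht⟩ := tendsto_prod_one_add_of_isEigenvalueSequence hl hv h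
  have h1 : ∀ k, 1 ≤ 1 + z * ev k := fun k => by nlinarith [mul_nonneg hz (h0 k)]
  -- For nonnegative terms, convergence of the partial sums already gives unconditional summability.
  rw [hasSum_iff_tendsto_nat_of_nonneg fun k => Real.log_nonneg (h1 k)]
  have hre := (Complex.continuous_re.tendsto _).comp (ht z)
  have hpos := (one_le_fredholmDet hl hv hz).2
  have hlog := (Real.continuousAt_log (by linarith :
    (fredholmDet l (fun x y => ⟪v x, v y⟫_ℂ) z).re ≠ 0)).tendsto.comp hre
  refine hlog.congr fun N => ?_
  simp only [Function.comp_def, Complex.ofReal_re]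
  exact Real.log_prod fun k _ => by linarith [h1 k]

end Main

end

end LinearAntenna

/-! ### The theorem for the Green's function. -/

theorem theorem1 (l d wl Z₀ P n₀ : ℝ) (hl : 0 < l) (hd : 0 < d) (hwl : 0 < wl) (hZ₀ : 0 < Z₀)
    (hP : 0 < P) (hn₀ : 0 < n₀) :
    -- the quantities entering the logarithms are well defined and positive
    (∀ m : ℕ, 1 ≤ m →
      0 < LinearAntenna.noisePower l d wl Z₀ P n₀ m ∧
      (LinearAntenna.discreteDet l d wl Z₀ P n₀ m).im = 0 ∧
      0 < (LinearAntenna.discreteDet l d wl Z₀ P n₀ m).re) ∧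
    Summable (LinearAntenna.fredholmTerm l (LinearAntenna.fieldKernel l d wl Z₀ P)
      ((1 / (n₀ / 2) : ℝ) : ℂ)) ∧
    (LinearAntenna.fredholmDet l (LinearAntenna.fieldKernel l d wl Z₀ P)
      ((1 / (n₀ / 2) : ℝ) : ℂ)).im = 0 ∧
    0 < (LinearAntenna.fredholmDet l (LinearAntenna.fieldKernel l d wl Z₀ P)
      ((1 / (n₀ / 2) : ℝ) : ℂ)).re ∧
    -- the eigenvalue formula for the continuous mutual information
    (∃ ev : ℕ → ℝ, LinearAntenna.IsEigenvalueSequence l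
      (LinearAntenna.fieldKernel l d wl Z₀ P) ev) ∧
    (∀ ev : ℕ → ℝ,
      LinearAntenna.IsEigenvalueSequence l (LinearAntenna.fieldKernel l d wl Z₀ P) ev →
        (∀ k, 0 ≤ ev k) ∧
        HasSum (fun k => Real.log (1 + ev k / (n₀ / 2)))
          (LinearAntenna.contInfo l d wl Z₀ P n₀)) ∧
    -- convergence and its rate
    Filter.Tendsto (fun m : ℕ => LinearAntenna.discreteInfo l d wl Z₀ P n₀ m) Filter.atTop
      (nhds (LinearAntenna.contInfo l d wl Z₀ P n₀)) ∧
    ∃ C : ℝ, ∀ m : ℕ, 1 ≤ m →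
      |LinearAntenna.discreteInfo l d wl Z₀ P n₀ m - LinearAntenna.contInfo l d wl Z₀ P n₀|
        ≤ C / (m : ℝ) ^ 2 := by
  have hg : ContDiff ℝ 2 (LinearAntenna.radialGreen d wl Z₀) :=
    LinearAntenna.contDiff_radialGreen hd hwl
  have hgc := hg.continuous
  have hge : ∀ x, LinearAntenna.radialGreen d wl Z₀ (-x) = LinearAntenna.radialGreen d wl Z₀ x :=
    LinearAntenna.radialGreen_neg
  have hg0 := LinearAntenna.radialGreen_ne_zero hd hwl hZ₀
  set z : ℝ := 1 / (n₀ / 2) with hz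
  have hz0 : 0 < z := by positivity
  have hv := LinearAntenna.continuous_feature hgc hl.le hP.le
  have hK : LinearAntenna.fieldKernel l d wl Z₀ P = fun x y =>
      inner ℂ (LinearAntenna.feature hgc l P x) (LinearAntenna.feature hgc l P y) := by
    funext x y
    rw [LinearAntenna.inner_feature hgc hl.le hP.le, LinearAntenna.fieldKernel_eq_autocorr]
  have hnoise : ∀ m, LinearAntenna.noisePower l d wl Z₀ P n₀ m =
      LinearAntenna.controlledNoise l P n₀ (LinearAntenna.radialGreen d wl Z₀) m := fun m => by
    rw [LinearAntenna.noisePower, LinearAntenna.fieldKernel_eq_autocorr,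
      LinearAntenna.controlledNoise]
  have hnoise0 : ∀ m, 1 ≤ m → 0 < LinearAntenna.noisePower l d wl Z₀ P n₀ m := fun m hm => by
    rw [hnoise]; exact LinearAntenna.controlledNoise_pos hl hP hgc hg0 hn₀ hm
  have hdet : ∀ m, LinearAntenna.discreteDet l d wl Z₀ P n₀ m =
      (1 + ((1 / (LinearAntenna.controlledNoise l P n₀ (LinearAntenna.radialGreen d wl Z₀) m / 2) :
        ℝ) : ℂ) • Matrix.of fun i j : Fin m => LinearAntenna.autocorr l P
          (LinearAntenna.radialGreen d wl Z₀) (LinearAntenna.antenna l m i)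
          (LinearAntenna.antenna l m j)).det := fun m => by
    rw [LinearAntenna.discreteDet, hnoise, LinearAntenna.fieldKernel_eq_autocorr]
    congr 1
    ext i j
    simp only [Matrix.of_apply, Matrix.add_apply, Matrix.smul_apply, Matrix.one_apply,
      smul_eq_mul]
    push_cast
    ring
  have hdet1 : ∀ m, 1 ≤ m → 1 ≤ (LinearAntenna.discreteDet l d wl Z₀ P n₀ m).re ∧
      (LinearAntenna.discreteDet l d wl Z₀ P n₀ m).im = 0 := fun m hm => by
    have h := LinearAntenna.one_le_det_one_add_autocorr hl.le hP.le hgc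
      (LinearAntenna.antenna l m) (w := 1 / (LinearAntenna.controlledNoise l P n₀
        (LinearAntenna.radialGreen d wl Z₀) m / 2)) (by
          have := LinearAntenna.controlledNoise_pos hl hP hgc hg0 hn₀ hm
          positivity)
    rw [← hdet, Complex.le_def] at h
    exact ⟨h.1, h.2.symm⟩
  obtain ⟨hFim, hFre⟩ := LinearAntenna.one_le_fredholmDet hl hv hz0.le
  rw [← hK] at hFim hFre
  obtain ⟨C, hC⟩ := LinearAntenna.exists_norm_det_sub_fredholmDet_le hl hP hg hge hg0 hn₀
  have hrate : ∀ m : ℕ, 1 ≤ m → |LinearAntenna.discreteInfo l d wl Z₀ P n₀ m -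
      LinearAntenna.contInfo l d wl Z₀ P n₀| ≤ C / (m : ℝ) ^ 2 := fun m hm => by
    refine (LinearAntenna.abs_log_sub_log_le (hdet1 m hm).1 hFre).trans ?_
    rw [← Complex.sub_re]
    refine (Complex.abs_re_le_norm _).trans ?_
    rw [hdet, LinearAntenna.fieldKernel_eq_autocorr]
    exact hC m hm
  refine ⟨fun m hm => ⟨hnoise0 m hm, (hdet1 m hm).2, by linarith [(hdet1 m hm).1]⟩, ?_, hFim,
    by linarith, ?_, ?_, ?_, C, hrate⟩
  · obtain ⟨B, hB0, hB⟩ := LinearAntenna.exists_norm_sub_le hgc l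
    rw [LinearAntenna.fieldKernel_eq_autocorr]
    exact LinearAntenna.summable_fredholmTerm hl.le (M := P * (l * B ^ 2)) (by positivity)
      (fun x hx y hy => LinearAntenna.norm_autocorr_le hl.le hP.le hB0 hB hx hy) _
  · rw [hK]
    exact LinearAntenna.exists_isEigenvalueSequence hl hv
  · intro ev hev
    rw [hK] at hev
    refine ⟨(LinearAntenna.tendsto_prod_one_add_of_isEigenvalueSequence hl hv hev).1, ?_⟩
    have h := LinearAntenna.hasSum_log_one_add_eigenvalue hl hv hev hz0.le
    rw [← hK] at h
    refine h.congr_fun fun k => ?_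
    rw [hz]; congr 1; ring
  · rw [tendsto_iff_dist_tendsto_zero]
    refine squeeze_zero' (g := fun m : ℕ => C / (m : ℝ) ^ 2)
      (Filter.Eventually.of_forall fun _ => dist_nonneg)
      (Filter.eventually_atTop.2 ⟨1, fun m hm => by rw [Real.dist_eq]; exact hrate m hm⟩) ?_
    exact Filter.Tendsto.div_atTop tendsto_const_nhds
      ((Filter.tendsto_pow_atTop two_ne_zero).comp tendsto_natCast_atTop_atTop)
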